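/- Let $p$ be a prime, let $q$ be a power of $p$ (with $q>1$), and let $\mathbb{F}_q$ be the field with $q$ elements. Let $G_p(U)$ be the rational function $$G_p(U)=\frac{(1-U^p)-(1-U)^p}{p\,(1-U)^p},$$ where the numerator $(1-U^p)-(1-U)^p\in p\,\mathbb{Z}[U]$ is divided by $p$ in $\mathbb{Z}[U]$ before reducing modulo $p$, so that $G_p(U)\in\mathbb{F}_p(U)$. Let $\mathcal{P}_1$ be the set of monic irreducible polynomials in $\mathbb{F}_q[T]$. Infinite sums of elements of $\mathbb{F}_q(T)$ are taken in the $T^{-1}$-adic completion of $\mathbb{F}_q(T)$. Let $k=(q-1)\ell$, where $\ell$ is an integer. If $1\le \ell\le q/p$, then the following sum converges and $$\sum_{P\in\mathcal{P}_1} G_p(1/P^k)=0 .$$ If $q/p+1<\ell\le 2q/p$, then the following sum converges and $$\sum_{P\in\mathcal{P}_1} G_p(1/P^k)=\ell\,\frac{(T^q-T)^{q+1}}{(T^{q^2}-T^q)(T^{q^2}-T)} .$$ -/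

import Mathlib

open Polynomial

noncomputable section

namespace PrimeSums

/-- The integral polynomial `((1 - U^p) - (1 - U)^p) / p`: every coefficient of
`(1 - U^p) - (1 - U)^p`, which has degree at most `p`, is divided by `p` in the integers
(for `p` prime the divisions are exact, see `C_mul_numer`). -/
def numer (p : ℕ) : ℤ[X] :=
  ∑ j ∈ Finset.range (p + 1),
    monomial j ((((1 : ℤ[X]) - X ^ p) - (1 - X) ^ p).coeff j / (p : ℤ))

/-- The value at `u` of the rational function
`G_p(U) = ((1 - U^p) - (1 - U)^p) / (p (1 - U)^p)`; the division by `p` takes place over the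
integers, so that `u` may lie in a field of characteristic `p`. -/
def G (p : ℕ) {K : Type*} [Field K] (u : K) : K :=
  aeval u (numer p) / (1 - u) ^ p

/-- The monic irreducible polynomials over `F`. -/
abbrev MonicIrreducible (F : Type*) [Field F] : Type _ :=
  {P : F[X] // P.Monic ∧ Irreducible P}

/-- `numer p` is characterized by `p * numer p = (1 - U^p) - (1 - U)^p` in `ℤ[U]`. -/
theorem C_mul_numer (p : ℕ) (hp : p.Prime) :
    C (p : ℤ) * numer p = (1 - X ^ p) - (1 - X) ^ p := by
  have : Fact p.Prime := ⟨hp⟩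
  have hdvd : ∀ j, (p : ℤ) ∣ (((1 : ℤ[X]) - X ^ p) - (1 - X) ^ p).coeff j := by
    intro j
    have h0 : ((((1 : ℤ[X]) - X ^ p) - (1 - X) ^ p).map (Int.castRingHom (ZMod p))) = 0 := by
      simp only [Polynomial.map_sub, Polynomial.map_one, Polynomial.map_pow, Polynomial.map_X]
      rw [sub_pow_char]
      simp
    have h1 := congrArg (fun f => f.coeff j) h0
    simp only [coeff_map, coeff_zero, eq_intCast] at h1
    exact (ZMod.intCast_zmod_eq_zero_iff_dvd _ p).mp h1
  have hdeg : ((((1 : ℤ[X]) - X ^ p) - (1 - X) ^ p)).natDegree < p + 1 := by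
    refine Nat.lt_succ_of_le ?_
    have h1 : ((1 : ℤ[X]) - X).natDegree ≤ 1 := by compute_degree
    have h2 : (((1 : ℤ[X]) - X) ^ p).natDegree ≤ p := by
      refine natDegree_pow_le.trans ?_
      nlinarith
    have h3 : ((1 : ℤ[X]) - X ^ p).natDegree ≤ p := by compute_degree
    exact (natDegree_sub_le _ _).trans (max_le h3 h2)
  conv_rhs => rw [as_sum_range' _ (p + 1) hdeg]
  rw [numer, Finset.mul_sum]
  refine Finset.sum_congr rfl fun j _ => ?_
  rw [C_mul_monomial, Int.mul_ediv_cancel' (hdvd j)]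

end PrimeSums

end

/-! Put x(a) = a^{-(q-1)}, and let Z_m be the sum of x(a)^m over the monic a of degree at most d. Up
to terms of degree above d, Z_m is inverse to the product of the 1 - x(P)^m. Since 1 - u^p = (1-u)^p
(1 + p G_p(u)), comparing the p-th power of this Euler product for m = ℓ with the one for m = ℓp
produces p ∑ G_p(x(P)^ℓ) modulo p² on the side of the primes, and Z_ℓ^p - Z_{ℓp} = pW on the other
side. The factor p is cancelled in the monoid algebra of `F[X]` over ℤ, modulo the ideal `degIdeal`,
whose quotient is torsion-free; only afterwards is everything mapped to characteristic p. The
outcome is Z_ℓ^p ∑ G_p ≈ W (`exists_mem_degIdeal_of_sum_G`).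

To compute W, let e_j be the elementary symmetric functions of the x(a). Up to sign they are the
coefficients at X^{(q-1)j+1} of the polynomial whose roots are all polynomials of degree at most d,
scaled to have linear term X. Its roots form an F-space, so only exponents q^i occur, and for 1 ≤ j
≤ 2q only e_1 and e_{q+1} survive (`monicEsymm_eq_zero`). Newton's identities, again read in
characteristic zero, give W = 0 for ℓp ≤ q and W = ℓ e_{q+1} e_1^{ℓp-q-1} for q < ℓp ≤ 2q
(`aeval_of_esymm_sparse`, with (-1)^{q+1} = 1 in F), while Z_ℓ = e_1^ℓ. Hence ∑ G_p ≈ ℓ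
e_{q+1}/e_1^{q+1} in the second case.

This ratio tends to (T^q - T)/(T^{q²} - T): the polynomials of degree at most d+1 arise from those
of degree at most d either by adjoining T^{d+1}, or by multiplying by T and adjoining 1, and the two
recursions together tie e_{q+1} to e_1 (`normCoeff_two_sub`). Every error is at most |T|^{-d}, and
e_1 and the Euler products have absolute value 1. -/

noncomputable section

namespace PrimeSums

/-! ### Newton's identities with sparse elementary symmetric functions -/

section Newton

/-- Newton's identities relating elementary symmetric functions `e` and power sums `s`. -/
def NewtonRel {A : Type*} [CommRing A] (e s : ℕ → A) : Prop :=
  ∀ k, 0 < k → s k = (-1) ^ (k + 1) * k * e k -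
    ∑ a ∈ Finset.HasAntidiagonal.antidiagonal k with a.1 ∈ Set.Ioo 0 k, (-1) ^ a.1 * e a.1 * s a.2

variable {A : Type*} [CommRing A] {e s : ℕ → A} {q : ℕ}

theorem NewtonRel.one (h : NewtonRel e s) : s 1 = e 1 := by
  rw [h 1 one_pos, Finset.sum_eq_zero]
  · simp
  · intro a ha
    simp only [Finset.mem_filter, Finset.HasAntidiagonal.mem_antidiagonal, Set.mem_Ioo] at ha
    omega

/-- If `e j = 0` for `2 ≤ j ≤ 2q` except for `j = q + 1`, the sum in Newton's identity has at most
two terms. -/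
theorem NewtonRel.sparse (h : NewtonRel e s)
    (he : ∀ j, 2 ≤ j → j ≤ 2 * q → j ≠ q + 1 → e j = 0) {n : ℕ} (hn : 2 ≤ n) (hn' : n ≤ 2 * q) :
    s n = (-1) ^ (n + 1) * n * e n + e 1 * s (n - 1) +
      if 1 ≤ q ∧ q + 1 < n then (-1) ^ q * e (q + 1) * s (n - q - 1) else 0 := by
  rw [h n (by omega), sub_eq_add_neg, add_assoc]
  congr 1
  have h1 : ((1, n - 1) : ℕ × ℕ) ∈
      (Finset.HasAntidiagonal.antidiagonal n).filter (fun a => a.1 ∈ Set.Ioo 0 n) := by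
    simp only [Finset.mem_filter, Finset.HasAntidiagonal.mem_antidiagonal, Set.mem_Ioo]; omega
  split_ifs with hq
  · have h2 : ((q + 1, n - q - 1) : ℕ × ℕ) ∈
        (Finset.HasAntidiagonal.antidiagonal n).filter (fun a => a.1 ∈ Set.Ioo 0 n) := by
      simp only [Finset.mem_filter, Finset.HasAntidiagonal.mem_antidiagonal, Set.mem_Ioo]; omega
    rw [Finset.sum_eq_add_of_mem _ _ h1 h2]
    · ring
    · simp only [ne_eq, Prod.mk.injEq]; omega
    · rintro ⟨a, b⟩ hab ⟨hne1, hne2⟩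
      simp only [Finset.mem_filter, Finset.HasAntidiagonal.mem_antidiagonal, Set.mem_Ioo, ne_eq,
        Prod.mk.injEq] at hab hne1 hne2
      simp [he a (by omega) (by omega) (by omega)]
  · rw [Finset.sum_eq_single_of_mem _ h1]
    · ring
    · rintro ⟨a, b⟩ hab hne1
      simp only [Finset.mem_filter, Finset.HasAntidiagonal.mem_antidiagonal, Set.mem_Ioo, ne_eq,
        Prod.mk.injEq] at hab hne1
      simp [he a (by omega) (by omega) (by omega)]

theorem NewtonRel.eq_pow (h : NewtonRel e s)
    (he : ∀ j, 2 ≤ j → j ≤ 2 * q → j ≠ q + 1 → e j = 0) {n : ℕ} (hn : 1 ≤ n) (hn' : n ≤ q) :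
    s n = e 1 ^ n := by
  induction n, hn using Nat.le_induction with
  | base => rw [h.one, pow_one]
  | succ n hn ih =>
    rw [h.sparse he (by omega) (by omega), if_neg (by omega),
      he (n + 1) (by omega) (by omega) (by omega), Nat.add_sub_cancel, ih (by omega)]
    ring

/-- The term n e_n of Newton's identity contributes q + 1 copies of e_{q+1} at n = q + 1; each later
step adds one more through e_{q+1} s_{n-q-1}, where s is still a pure power of e_1. -/
theorem NewtonRel.eq_pow_add (h : NewtonRel e s)
    (he : ∀ j, 2 ≤ j → j ≤ 2 * q → j ≠ q + 1 → e j = 0) {n : ℕ} (hn : q + 1 ≤ n)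
    (hn' : n ≤ 2 * q) :
    s n = e 1 ^ n + (-1) ^ q * n * e (q + 1) * e 1 ^ (n - (q + 1)) := by
  induction n, hn using Nat.le_induction with
  | base =>
    rw [h.sparse he (by omega) (by omega), if_neg (by omega), Nat.add_sub_cancel,
      h.eq_pow he (by omega) le_rfl]
    simp only [Nat.sub_self]
    ring
  | succ n hn ih =>
    rw [h.sparse he (by omega) (by omega), if_pos (by omega),
      he (n + 1) (by omega) (by omega) (by omega), Nat.add_sub_cancel, ih (by omega),
      h.eq_pow he (n := n + 1 - q - 1) (by omega) (by omega)]
    obtain ⟨m, rfl⟩ := Nat.exists_eq_add_of_le hn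
    rw [show q + 1 + m + 1 - q - 1 = m + 1 by omega, show q + 1 + m - (q + 1) = m by omega,
      show q + 1 + m + 1 - (q + 1) = m + 1 by omega]
    push_cast
    ring

theorem newtonRel_aeval {σ : Type*} [Fintype σ] (x : σ → A) :
    NewtonRel (fun j => MvPolynomial.aeval x (MvPolynomial.esymm σ ℤ j))
      (fun n => MvPolynomial.aeval x (MvPolynomial.psum σ ℤ n)) := by
  classical
  intro k hk
  have := congrArg (MvPolynomial.aeval x) (MvPolynomial.psum_eq_mul_esymm_sub_sum σ ℤ k hk)
  simpa using this

/-- Killing the elementary symmetric polynomials of index in `[2, 2q] \ {q + 1}`: a homomorphism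
from the symmetric polynomials to a torsion-free ring through which the evaluation at every `x`
at which these elementary symmetric polynomials vanish factors. -/
theorem exists_esymm_sparse_lift {σ : Type*} [Fintype σ] (q : ℕ) (x : σ → A)
    (hx : ∀ j, 2 ≤ j → j ≤ 2 * q → j ≠ q + 1 →
      MvPolynomial.aeval x (MvPolynomial.esymm σ ℤ j) = 0) :
    ∃ (θ : MvPolynomial.symmetricSubalgebra σ ℤ →ₐ[ℤ] MvPolynomial (Fin (Fintype.card σ)) ℤ)
      (ε : MvPolynomial (Fin (Fintype.card σ)) ℤ →ₐ[ℤ] A),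
      (∀ f, ε (θ f) = MvPolynomial.aeval x f.1) ∧
      ∀ j, 2 ≤ j → j ≤ 2 * q → j ≠ q + 1 →
        θ ⟨MvPolynomial.esymm σ ℤ j, MvPolynomial.esymm_isSymmetric σ ℤ j⟩ = 0 := by
  classical
  set N := Fintype.card σ with hN
  let κ : MvPolynomial (Fin N) ℤ →ₐ[ℤ] MvPolynomial (Fin N) ℤ := MvPolynomial.aeval fun i =>
    if 2 ≤ i.1 + 1 ∧ i.1 + 1 ≤ 2 * q ∧ i.1 + 1 ≠ q + 1 then 0 else MvPolynomial.X i
  let ε : MvPolynomial (Fin N) ℤ →ₐ[ℤ] A := MvPolynomial.aeval fun i =>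
    MvPolynomial.aeval x (MvPolynomial.esymm σ ℤ (i.1 + 1))
  let Ψ := MvPolynomial.esymmAlgEquiv σ ℤ hN.symm
  refine ⟨κ.comp Ψ.symm.toAlgHom, ε, fun f => ?_, fun j h1 h2 h3 => ?_⟩
  · obtain ⟨g, rfl⟩ := Ψ.surjective f
    -- The variables killed by `κ` already go to zero under `ε`, by the hypothesis on `x`.
    have hκ : ε.comp κ = ε := by
      refine MvPolynomial.algHom_ext fun i => ?_
      simp only [κ, ε, AlgHom.comp_apply, MvPolynomial.aeval_X]
      split_ifs with h
      · rw [map_zero, hx _ h.1 h.2.1 h.2.2]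
      · rw [MvPolynomial.aeval_X]
    have hΨ : ε = ((MvPolynomial.aeval x).comp
        (MvPolynomial.symmetricSubalgebra σ ℤ).val).comp Ψ.toAlgHom := by
      refine MvPolynomial.algHom_ext fun i => ?_
      have : Ψ (MvPolynomial.X i) =
          ⟨MvPolynomial.esymm σ ℤ (i + 1), MvPolynomial.esymm_isSymmetric σ ℤ _⟩ := by
        rw [← MvPolynomial.esymmAlgEquiv_symm_apply ℤ hN.symm i, AlgEquiv.apply_symm_apply]
      simp only [AlgHom.comp_apply, ε, MvPolynomial.aeval_X]
      change _ = MvPolynomial.aeval x (Ψ (MvPolynomial.X i)).1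
      rw [this]
    change ε (κ (Ψ.symm (Ψ g))) = _
    rw [AlgEquiv.symm_apply_apply, ← AlgHom.comp_apply, hκ]
    exact congrArg (fun h => h g) hΨ
  · change κ (Ψ.symm _) = 0
    by_cases hj : j ≤ N
    · have := MvPolynomial.esymmAlgEquiv_symm_apply ℤ hN.symm ⟨j - 1, by omega⟩
      simp only [show j - 1 + 1 = j by omega] at this
      rw [this]
      simp only [κ, MvPolynomial.aeval_X]
      rw [if_pos]
      omega
    · have : (⟨MvPolynomial.esymm σ ℤ j, MvPolynomial.esymm_isSymmetric σ ℤ j⟩ :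
          MvPolynomial.symmetricSubalgebra σ ℤ) = 0 := by
        refine Subtype.ext ?_
        change MvPolynomial.esymm σ ℤ j = 0
        rw [MvPolynomial.esymm, Finset.powersetCard_eq_empty.mpr (by rw [Finset.card_univ]; omega),
          Finset.sum_empty]
      rw [this, map_zero, map_zero]

/-- Modulo p, raising to the p-th power is additive. -/
theorem exists_psum_pow_sub_psum {σ : Type*} [Fintype σ] (p : ℕ) [hp : Fact p.Prime] (l : ℕ) :
    ∃ W : MvPolynomial σ ℤ, (p : MvPolynomial σ ℤ) * W =
      MvPolynomial.psum σ ℤ l ^ p - MvPolynomial.psum σ ℤ (l * p) := by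
  have h : MvPolynomial.C (p : ℤ) ∣
      MvPolynomial.psum σ ℤ l ^ p - MvPolynomial.psum σ ℤ (l * p) := by
    rw [MvPolynomial.C_dvd_iff_zmod, map_sub, map_pow]
    simp only [MvPolynomial.psum, map_sum, map_pow, MvPolynomial.map_X]
    rw [sum_pow_char, sub_eq_zero]
    simp_rw [pow_mul]
  obtain ⟨W, hW⟩ := h
  exact ⟨W, by rw [hW]; simp⟩

variable {σ : Type*} [Fintype σ] {p l : ℕ} [hp : Fact p.Prime] {W : MvPolynomial σ ℤ}

theorem isSymmetric_of_mul_eq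
    (hW : (p : MvPolynomial σ ℤ) * W =
      MvPolynomial.psum σ ℤ l ^ p - MvPolynomial.psum σ ℤ (l * p)) : W.IsSymmetric := by
  intro τ
  have hp0 : (p : MvPolynomial σ ℤ) ≠ 0 := by exact_mod_cast hp.out.ne_zero
  refine mul_left_cancel₀ hp0 ?_
  have h1 := congrArg (MvPolynomial.rename τ) hW
  rw [map_mul, map_natCast, map_sub, map_pow, MvPolynomial.psum_isSymmetric,
    MvPolynomial.psum_isSymmetric] at h1
  rw [h1, hW]

/-- The value of `(psum l ^ p - psum (l * p)) / p` at a point at which the elementary symmetric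
polynomials of index in `[2, 2q] \ {q + 1}` vanish. -/
theorem aeval_of_esymm_sparse (x : σ → A)
    (hx : ∀ j, 2 ≤ j → j ≤ 2 * q → j ≠ q + 1 →
      MvPolynomial.aeval x (MvPolynomial.esymm σ ℤ j) = 0)
    (hW : (p : MvPolynomial σ ℤ) * W =
      MvPolynomial.psum σ ℤ l ^ p - MvPolynomial.psum σ ℤ (l * p)) (hl : 1 ≤ l) (hlq : l ≤ q) :
    (l * p ≤ q → MvPolynomial.aeval x W = 0) ∧
    (q + 1 ≤ l * p → l * p ≤ 2 * q → MvPolynomial.aeval x W =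
      (-1) ^ (q + 1) * l * MvPolynomial.aeval x (MvPolynomial.esymm σ ℤ (q + 1)) *
        MvPolynomial.aeval x (MvPolynomial.esymm σ ℤ 1) ^ (l * p - (q + 1))) := by
  classical
  obtain ⟨θ, ε, hε, hθ⟩ := exists_esymm_sparse_lift q x hx
  let E : ℕ → MvPolynomial.symmetricSubalgebra σ ℤ := fun j =>
    ⟨MvPolynomial.esymm σ ℤ j, MvPolynomial.esymm_isSymmetric σ ℤ j⟩
  let S : ℕ → MvPolynomial.symmetricSubalgebra σ ℤ := fun j =>
    ⟨MvPolynomial.psum σ ℤ j, MvPolynomial.psum_isSymmetric σ ℤ j⟩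
  let V : MvPolynomial.symmetricSubalgebra σ ℤ := ⟨W, isSymmetric_of_mul_eq hW⟩
  have hN : NewtonRel (fun j => θ (E j)) (fun n => θ (S n)) := by
    intro k hk
    have h : S k = (-1) ^ (k + 1) * k * E k -
        ∑ a ∈ Finset.HasAntidiagonal.antidiagonal k with a.1 ∈ Set.Ioo 0 k,
          (-1) ^ a.1 * E a.1 * S a.2 := by
      refine Subtype.ext ?_
      have := MvPolynomial.psum_eq_mul_esymm_sub_sum σ ℤ k hk
      simpa [E, S] using this
    have := congrArg θ h
    simpa using this
  -- This is the reason for passing through `θ`: its target allows cancelling `p`, whereas `A` may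
  -- have characteristic `p`.
  have hp0 : (p : MvPolynomial (Fin (Fintype.card σ)) ℤ) ≠ 0 := by
    exact_mod_cast hp.out.ne_zero
  have hV : (p : MvPolynomial (Fin (Fintype.card σ)) ℤ) * θ V = θ (S l) ^ p - θ (S (l * p)) := by
    have h : (p : MvPolynomial.symmetricSubalgebra σ ℤ) * V = S l ^ p - S (l * p) :=
      Subtype.ext (by simpa [V, S] using hW)
    have := congrArg θ h
    simpa using this
  rw [hN.eq_pow hθ hl hlq, ← pow_mul] at hV
  have hVx : MvPolynomial.aeval x W = ε (θ V) := (hε V).symm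
  refine ⟨fun h => ?_, fun h h' => ?_⟩
  · rw [hN.eq_pow hθ (Nat.mul_pos hl hp.out.pos) h, sub_self] at hV
    rw [hVx, (mul_eq_zero.mp hV).resolve_left hp0, map_zero]
  · rw [hN.eq_pow_add hθ h h'] at hV
    have : θ V = (-1) ^ (q + 1) * l * θ (E (q + 1)) * θ (E 1) ^ (l * p - (q + 1)) := by
      refine mul_left_cancel₀ hp0 ?_
      rw [hV]
      push_cast
      ring
    rw [hVx, this]
    simp only [map_mul, map_pow, map_neg, map_one, map_natCast, hε]
    rfl

end Newton

/-! ### Truncated Euler products and division by p -/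

section FiniteEuler

theorem one_sub_pow_eq {A : Type*} [CommRing A] (p : ℕ) (hp : p.Prime) (u : A) :
    1 - u ^ p = (1 - u) ^ p + p * aeval u (numer p) := by
  have h := congrArg (aeval u) (C_mul_numer p hp)
  simp only [map_mul, map_sub, map_pow, map_one, aeval_X] at h
  rw [aeval_C, eq_intCast, Int.cast_natCast] at h
  rw [h]
  ring

/-- The logarithm-like behaviour of `G p`: modulo `p²` a product of `1 - u ^ p` differs from the
`p`-th power of the product of `1 - u` by `p` times a sum of values of `G p`. -/
theorem exists_prod_one_sub_pow {A K ι : Type*} [CommRing A] [Field K] (p : ℕ) (hp : p.Prime)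
    [CharP K p] (φ : A →+* K) (s : Finset ι) (u : ι → A) (hu : ∀ i ∈ s, φ (u i) ≠ 1) :
    ∃ H : A, ∏ i ∈ s, (1 - u i ^ p) = (∏ i ∈ s, (1 - u i)) ^ p + p * H ∧
      φ H = φ (∏ i ∈ s, (1 - u i)) ^ p * ∑ i ∈ s, G p (φ (u i)) := by
  classical
  induction s using Finset.induction_on with
  | empty => exact ⟨0, by simp⟩
  | insert i s hi ih =>
    obtain ⟨H, h1, h2⟩ := ih fun j hj => hu j (Finset.mem_insert_of_mem hj)
    have hne : (1 - φ (u i)) ^ p ≠ 0 :=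
      pow_ne_zero _ (sub_ne_zero.mpr (hu i (Finset.mem_insert_self _ _)).symm)
    have hN : φ (aeval (u i) (numer p)) = G p (φ (u i)) * (1 - φ (u i)) ^ p := by
      rw [G, div_mul_cancel₀ _ hne]
      have := Polynomial.hom_eval₂ (numer p) (algebraMap ℤ A) φ (u i)
      rw [aeval_def, this, aeval_def]
      congr 1
      exact RingHom.ext_int _ _
    -- The witness is the cofactor of `p` in (π^p + pH)((1-u)^p + pN); its last summand carries a
    -- further `p` and dies under `φ`.
    refine ⟨H * (1 - u i) ^ p + (∏ i ∈ s, (1 - u i)) ^ p * aeval (u i) (numer p) +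
      p * (H * aeval (u i) (numer p)), ?_, ?_⟩
    · rw [Finset.prod_insert hi, Finset.prod_insert hi, h1, one_sub_pow_eq p hp, mul_pow]
      ring
    · rw [Finset.prod_insert hi, Finset.sum_insert hi]
      simp only [map_add, map_mul, map_pow, map_sub, map_one, map_natCast, h2, hN,
        CharP.cast_eq_zero K p, mul_pow]
      ring

/-- Comparison of two approximate Euler products modulo an ideal with torsion-free quotient. -/
theorem pow_mul_sub_mem {A : Type*} [CommRing A] (I : Ideal A) (p : ℕ)
    (hI : ∀ x, (p : A) * x ∈ I → x ∈ I) {Z Z' π π' W H : A}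
    (h1 : Z * π - 1 ∈ I) (h2 : Z' * π' - 1 ∈ I) (hW : (p : A) * W = Z ^ p - Z')
    (hH : π' = π ^ p + p * H) : Z ^ p * H - W * π ^ p - p * (W * H) ∈ I := by
  apply hI
  have e : (p : A) * (Z ^ p * H - W * π ^ p - p * (W * H)) =
      (Z' * π' - 1) - ((Z * π) ^ p - 1 ^ p) := by
    have : Z' = Z ^ p - p * W := by rw [hW]; ring
    rw [this, hH]; ring
  rw [e]
  exact I.sub_mem h2 (I.mem_of_dvd (sub_dvd_pow_sub_pow _ _ _) h1)

variable {F : Type*} [Field F]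

variable (F) in
/-- The ideal of the monoid algebra of `F[X]` spanned by the polynomials of degree greater than
`d` (and by zero). -/
def degIdeal (d : ℕ) : Ideal (MonoidAlgebra ℤ F[X]) :=
  Ideal.span (MonoidAlgebra.of ℤ F[X] '' {a | a = 0 ∨ d < a.natDegree})

theorem of_mem_degIdeal {d : ℕ} {a : F[X]} (h : d < a.natDegree) :
    MonoidAlgebra.of ℤ F[X] a ∈ degIdeal F d :=
  Ideal.subset_span ⟨a, Or.inr h, rfl⟩

/-- The ideal is spanned by basis elements, so membership depends only on the support, which a
nonzero integer factor does not change. -/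
theorem mem_degIdeal_of_natCast_mul_mem {d n : ℕ} (hn : n ≠ 0) (x : MonoidAlgebra ℤ F[X])
    (h : (n : MonoidAlgebra ℤ F[X]) * x ∈ degIdeal F d) : x ∈ degIdeal F d := by
  rw [degIdeal, MonoidAlgebra.mem_ideal_span_of_image] at h ⊢
  intro m hm
  refine h m ?_
  rw [Finsupp.mem_support_iff] at hm ⊢
  rw [← nsmul_eq_mul, MonoidAlgebra.coeff_smul, Finsupp.smul_apply, nsmul_eq_mul]
  exact mul_ne_zero (by exact_mod_cast hn) hm

theorem pow_mem_degIdeal {d m : ℕ} (hm : 1 ≤ m) {a : F[X]} (h : d < a.natDegree) :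
    ((MonoidAlgebra.of ℤ F[X]).comp (powMonoidHom m)) a ∈ degIdeal F d := by
  refine of_mem_degIdeal ?_
  rw [powMonoidHom_apply, natDegree_pow]
  nlinarith

/-- The ring homomorphism from the monoid algebra of `F[X]` induced by a multiplicative function. -/
def evalHom {K : Type*} [Field K] (x : F[X] →* K) : MonoidAlgebra ℤ F[X] →ₐ[ℤ] K :=
  MonoidAlgebra.lift ℤ K F[X] x

variable [Fintype F]

theorem finite_monic_natDegree_le (d : ℕ) : {a : F[X] | a.Monic ∧ a.natDegree ≤ d}.Finite := by
  have : Finite (degreeLT F (d + 1)) := Finite.of_equiv _ (degreeLTEquiv F (d + 1)).symm.toEquiv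
  refine (Set.toFinite ((degreeLT F (d + 1) : Submodule F F[X]) : Set F[X])).subset ?_
  rintro a ⟨-, ha⟩
  rw [SetLike.mem_coe, mem_degreeLT]
  exact degree_le_natDegree.trans_lt (by exact_mod_cast Nat.lt_succ_of_le ha)

variable (F) in
/-- The monic polynomials of degree at most `d`. -/
def monicsLE (d : ℕ) : Finset F[X] := (finite_monic_natDegree_le (F := F) d).toFinset

@[simp] theorem mem_monicsLE {d : ℕ} {a : F[X]} :
    a ∈ monicsLE F d ↔ a.Monic ∧ a.natDegree ≤ d := by simp [monicsLE]

open Classical in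
variable (F) in
/-- The monic irreducible polynomials of degree at most `d`. -/
def primesLE (d : ℕ) : Finset F[X] := (monicsLE F d).filter Irreducible

@[simp] theorem mem_primesLE {d : ℕ} {a : F[X]} :
    a ∈ primesLE F d ↔ (a.Monic ∧ a.natDegree ≤ d) ∧ Irreducible a := by simp [primesLE]

open Classical in
/-- The polynomials in `monicsLE F d` that no element of `Q` divides. -/
def sieved (d : ℕ) (Q : Finset F[X]) : Finset F[X] :=
  (monicsLE F d).filter fun a => ∀ P ∈ Q, ¬ P ∣ a

theorem mem_sieved {d : ℕ} {Q : Finset F[X]} {a : F[X]} :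
    a ∈ sieved d Q ↔ (a.Monic ∧ a.natDegree ≤ d) ∧ ∀ P ∈ Q, ¬ P ∣ a := by simp [sieved]

theorem sieved_primesLE (d : ℕ) : sieved d (primesLE F d) = {1} := by
  ext a
  rw [mem_sieved, Finset.mem_singleton]
  constructor
  · rintro ⟨⟨hm, hd⟩, h⟩
    by_contra hne
    have hu : ¬ IsUnit a := fun hu => hne (hm.eq_one_of_isUnit hu)
    obtain ⟨g, hg, hirr, hga⟩ := Polynomial.exists_monic_irreducible_factor a hu
    refine h g ?_ hga
    rw [mem_primesLE]
    exact ⟨⟨hg, (natDegree_le_of_dvd hga hm.ne_zero).trans hd⟩, hirr⟩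
  · rintro rfl
    refine ⟨⟨monic_one, by simp⟩, fun P hP h1 => ?_⟩
    rw [mem_primesLE] at hP
    exact hP.2.not_isUnit (isUnit_of_dvd_one h1)

/-- One step of the sieve of Eratosthenes: the sifted polynomials divisible by `P` are the products
`b * P` of degree at most `d` with `b` sifted, and the remaining products `b * P` lie in `I` by
their degree. -/
theorem sieve_step (d : ℕ) {A : Type*} [CommRing A] (I : Ideal A) (y : F[X] →* A)
    (hy : ∀ a : F[X], d < a.natDegree → y a ∈ I) (Q : Finset F[X]) (P : F[X])
    (hQ : ∀ R ∈ Q, R.Monic ∧ Irreducible R) (hP : P.Monic ∧ Irreducible P) (hPQ : P ∉ Q)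
    [DecidableEq F[X]] :
    ∑ a ∈ sieved d (insert P Q), y a - (∑ a ∈ sieved d Q, y a) * (1 - y P) ∈ I := by
  classical
  have h1 : ∑ a ∈ sieved d Q, y a =
      ∑ a ∈ sieved d (insert P Q), y a + ∑ a ∈ (sieved d Q).filter (fun a => P ∣ a), y a := by
    rw [← Finset.sum_filter_not_add_sum_filter (sieved d Q) (fun a => P ∣ a)]
    congr 1
    refine Finset.sum_congr ?_ fun _ _ => rfl
    ext a
    simp only [Finset.mem_filter, mem_sieved, Finset.forall_mem_insert]
    tauto
  have h2 : ∑ a ∈ (sieved d Q).filter (fun a => P ∣ a), y a =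
      ∑ b ∈ (sieved d Q).filter (fun b => (b * P).natDegree ≤ d), y (b * P) := by
    symm
    refine Finset.sum_bij (fun b _ => b * P) ?_ ?_ ?_ fun _ _ => rfl
    · intro b hb
      simp only [Finset.mem_filter, mem_sieved] at hb ⊢
      refine ⟨⟨⟨hb.1.1.1.mul hP.1, hb.2⟩, fun R hR hdvd => ?_⟩, dvd_mul_left _ _⟩
      rcases (hQ R hR).2.prime.dvd_or_dvd hdvd with h | h
      · exact hb.1.2 R hR h
      · have := eq_of_monic_of_associated (hQ R hR).1 hP.1
          ((hQ R hR).2.associated_of_dvd hP.2 h)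
        exact hPQ (this ▸ hR)
    · intro b _ c _ h
      exact mul_right_cancel₀ hP.1.ne_zero h
    · intro a ha
      simp only [Finset.mem_filter, mem_sieved] at ha
      obtain ⟨⟨⟨hm, hd⟩, hR⟩, b, rfl⟩ := ha
      have hb : b.Monic := hP.1.of_mul_monic_left hm
      refine ⟨b, ?_, mul_comm _ _⟩
      simp only [Finset.mem_filter, mem_sieved]
      refine ⟨⟨⟨hb, (natDegree_le_of_dvd (dvd_mul_left b P) hm.ne_zero).trans hd⟩,
        fun R hRQ h => hR R hRQ (h.mul_left P)⟩, by rwa [mul_comm]⟩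
  have h3 : (∑ a ∈ sieved d Q, y a) * y P =
      ∑ b ∈ (sieved d Q).filter (fun b => (b * P).natDegree ≤ d), y (b * P) +
      ∑ b ∈ (sieved d Q).filter (fun b => ¬ (b * P).natDegree ≤ d), y (b * P) := by
    rw [Finset.sum_filter_add_sum_filter_not, Finset.sum_mul]
    simp only [map_mul]
  have h4 : ∑ a ∈ sieved d (insert P Q), y a - (∑ a ∈ sieved d Q, y a) * (1 - y P) =
      ∑ b ∈ (sieved d Q).filter (fun b => ¬ (b * P).natDegree ≤ d), y (b * P) := by
    rw [mul_sub, mul_one, h3, h1, h2]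
    ring
  rw [h4]
  refine I.sum_mem fun b hb => hy _ ?_
  simpa using (Finset.mem_filter.mp hb).2

/-- The Euler product over the monic irreducible polynomials, truncated at degree `d`. -/
theorem sum_mul_prod_sub_one_mem (d : ℕ) {A : Type*} [CommRing A] (I : Ideal A) (y : F[X] →* A)
    (hy : ∀ a : F[X], d < a.natDegree → y a ∈ I) :
    (∑ a ∈ monicsLE F d, y a) * ∏ P ∈ primesLE F d, (1 - y P) - 1 ∈ I := by
  classical
  have key : ∀ Q : Finset F[X], (∀ R ∈ Q, R.Monic ∧ Irreducible R) →
      ∑ a ∈ sieved d Q, y a - (∑ a ∈ monicsLE F d, y a) * ∏ P ∈ Q, (1 - y P) ∈ I := by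
    intro Q
    induction Q using Finset.induction_on with
    | empty =>
      intro _
      have : sieved d (∅ : Finset F[X]) = monicsLE F d := by
        ext a; simp [mem_sieved]
      simp [this]
    | insert P Q hPQ ih =>
      intro h
      have hQ : ∀ R ∈ Q, R.Monic ∧ Irreducible R := fun R hR => h R (Finset.mem_insert_of_mem hR)
      have h1 := sieve_step d I y hy Q P hQ (h P (Finset.mem_insert_self _ _)) hPQ
      have h2 := I.mul_mem_right (1 - y P) (ih hQ)
      rw [Finset.prod_insert hPQ]
      convert I.add_mem h1 h2 using 1
      ring
  have := key (primesLE F d) fun R hR => by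
    rw [mem_primesLE] at hR; exact ⟨hR.1.1, hR.2⟩
  rw [sieved_primesLE, Finset.sum_singleton, map_one] at this
  rw [← neg_sub]
  exact I.neg_mem this

/-- The sum of `G p` over the monic irreducible polynomials of degree at most `d`, evaluated with
a multiplicative function `x`, in terms of symmetric functions of the values of `x` at the monic
polynomials of degree at most `d`, up to an element of the image of `degIdeal F d`. -/
theorem exists_mem_degIdeal_of_sum_G {K : Type*} [Field K] (p : ℕ) [hp : Fact p.Prime]
    [CharP K p] (x : F[X] →* K) (d l : ℕ) (hl : 1 ≤ l)
    (hx : ∀ P ∈ primesLE F d, x P ^ l ≠ 1) {W : MvPolynomial (monicsLE F d) ℤ}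
    (hW : (p : MvPolynomial (monicsLE F d) ℤ) * W =
      MvPolynomial.psum _ ℤ l ^ p - MvPolynomial.psum _ ℤ (l * p)) :
    ∃ g ∈ degIdeal F d, (evalHom x : MonoidAlgebra ℤ F[X] →+* K) g =
      (∏ P ∈ primesLE F d, (1 - x P ^ l)) ^ p *
        ((∑ a ∈ monicsLE F d, x a ^ l) ^ p * ∑ P ∈ primesLE F d, G p (x P ^ l) -
          MvPolynomial.aeval (fun a : monicsLE F d => x a) W) := by
  let φ : MonoidAlgebra ℤ F[X] →ₐ[ℤ] K := evalHom x
  let y : ℕ → F[X] →* MonoidAlgebra ℤ F[X] := fun m =>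
    (MonoidAlgebra.of ℤ F[X]).comp (powMonoidHom m)
  have hφ : ∀ m a, φ (y m a) = x a ^ m := by
    intro m a
    simp only [φ, evalHom, y, MonoidHom.comp_apply, powMonoidHom_apply, MonoidAlgebra.lift_of,
      map_pow]
  have hyp : ∀ m a, y (m * p) a = y m a ^ p := by
    intro m a
    simp only [y, MonoidHom.comp_apply, powMonoidHom_apply, map_pow, pow_mul]
  have h1 := sum_mul_prod_sub_one_mem d (degIdeal F d) (y l) fun a ha => pow_mem_degIdeal hl ha
  have h2 := sum_mul_prod_sub_one_mem d (degIdeal F d) (y (l * p)) fun a ha =>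
    pow_mem_degIdeal (Nat.mul_pos hl hp.out.pos) ha
  obtain ⟨H, hH, hφH⟩ := exists_prod_one_sub_pow p hp.out (φ : MonoidAlgebra ℤ F[X] →+* K)
    (primesLE F d) (y l) fun P hP => by
      change φ _ ≠ 1
      rw [hφ]; exact hx P hP
  simp_rw [hyp] at h2
  have hpsum : ∀ m, MvPolynomial.aeval (fun a : monicsLE F d => y 1 a)
      (MvPolynomial.psum (monicsLE F d) ℤ m) = ∑ a ∈ monicsLE F d, y m a := by
    intro m
    simp only [MvPolynomial.psum, map_sum, map_pow, MvPolynomial.aeval_X]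
    rw [Finset.sum_coe_sort (monicsLE F d) fun a => y 1 a ^ m]
    simp only [y, MonoidHom.comp_apply, powMonoidHom_apply, map_pow, pow_one]
  have hW' := congrArg (MvPolynomial.aeval fun a : monicsLE F d => y 1 a) hW
  rw [map_mul, map_natCast, map_sub, map_pow, hpsum, hpsum] at hW'
  simp_rw [hyp] at hW'
  refine ⟨_, pow_mul_sub_mem (degIdeal F d) p
    (fun z => mem_degIdeal_of_natCast_mul_mem hp.out.ne_zero z) h1 h2 hW' hH, ?_⟩
  change φ _ = _
  have hφW : φ (MvPolynomial.aeval (fun a : monicsLE F d => y 1 a) W) =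
      MvPolynomial.aeval (fun a : monicsLE F d => x a) W := by
    rw [← AlgHom.comp_apply, MvPolynomial.comp_aeval]
    simp only [hφ, pow_one]
  have hφH' : φ H = (∏ P ∈ primesLE F d, (1 - x P ^ l)) ^ p *
      ∑ P ∈ primesLE F d, G p (x P ^ l) := by
    refine Eq.trans hφH ?_
    simp only [map_prod, map_sub, map_one]
    simp only [RingHom.coe_coe, hφ]
  simp only [map_sub, map_mul, map_pow, map_sum, map_prod, map_one, hφ, hφW, hφH', map_natCast,
    CharP.cast_eq_zero K p]
  ring

end FiniteEuler

/-! ### Linearized polynomials and the recursion for their coefficients -/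

section Linearized

variable {F : Type*} [Field F] [Fintype F]

local notation "q" => Fintype.card F

theorem pow_card_eq_expand {K : Type*} [Field K] [Algebra F K] (f : K[X]) :
    f ^ q = expand K q (f.map (FiniteField.frobeniusAlgHom F K : K →+* K)) := by
  have : (FiniteField.frobeniusAlgHom F K[X] : K[X] →+* K[X]) =
      (expand K q : K[X] →+* K[X]).comp
        (mapRingHom (FiniteField.frobeniusAlgHom F K : K →+* K)) := by
    refine Polynomial.ringHom_ext (fun a => ?_) ?_
    · simp
    · simp
  exact congrArg (fun g : K[X] →+* K[X] => g f) this

theorem coeff_pow_card_mul {K : Type*} [Field K] [Algebra F K] (f : K[X]) (m : ℕ) :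
    (f ^ q).coeff (q * m) = f.coeff m ^ q := by
  rw [pow_card_eq_expand, coeff_expand_mul' Fintype.card_pos, coeff_map]
  simp

theorem coeff_pow_card_of_not_dvd {K : Type*} [Field K] [Algebra F K] (f : K[X]) {m : ℕ}
    (hm : ¬ q ∣ m) : (f ^ q).coeff m = 0 := by
  rw [pow_card_eq_expand, coeff_expand Fintype.card_pos, if_neg hm]

theorem sub_smul_pow_card_pow {B : Type*} [CommRing B] [Algebra F B] (x y : B) (c : F) (i : ℕ) :
    (x - c • y) ^ q ^ i = x ^ q ^ i - c • y ^ q ^ i := by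
  induction i with
  | zero => simp
  | succ i ih =>
    rw [pow_succ, pow_mul, ih, pow_mul, pow_mul]
    have := map_sub (FiniteField.frobeniusAlgHom F B) (x ^ q ^ i) (c • y ^ q ^ i)
    rw [map_smul] at this
    simpa using this

theorem prod_X_sub_C_univ : ∏ c : F, (X - C c) = X ^ q - X := by
  have hq : 1 < q := Fintype.one_lt_card
  have hm : (X ^ q - X : F[X]).Monic := monic_X_pow_sub (by simpa using hq)
  have := FiniteField.roots_X_pow_card_sub_X F
  rw [← prod_multiset_X_sub_C_of_monic_of_roots_card_eq hm, this]
  · rfl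
  · rw [this, FiniteField.X_pow_card_sub_X_natDegree_eq F hq]
    simp

/-- This is the homogenization of ∏ (X - c) = X^q - X. -/
theorem prod_sub_smul {K B : Type*} [Field K] [Algebra F K] [CommRing B] [Algebra F B]
    [Algebra K B] [IsScalarTower F K B] (x : B) (y : K) :
    ∏ c : F, (x - algebraMap K B (c • y)) = x ^ q - algebraMap K B y ^ (q - 1) * x := by
  have hq : 1 < q := Fintype.one_lt_card
  by_cases hy : y = 0
  · subst hy
    rw [map_zero, zero_pow (by omega)]
    simp
  · have h := congrArg (aeval (algebraMap K B y⁻¹ * x)) (prod_X_sub_C_univ (F := F))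
    simp only [map_prod, map_sub, aeval_X, aeval_C, map_pow] at h
    have hu : algebraMap K B y * algebraMap K B y⁻¹ = 1 := by
      rw [← map_mul, mul_inv_cancel₀ hy, map_one]
    have h1 : ∏ c : F, (x - algebraMap K B (c • y)) =
        algebraMap K B y ^ q * ∏ c : F, (algebraMap K B y⁻¹ * x - algebraMap F B c) := by
      rw [← Finset.card_univ, ← Finset.prod_const, ← Finset.prod_mul_distrib]
      refine Finset.prod_congr rfl fun c _ => ?_
      rw [mul_sub, ← mul_assoc, hu, one_mul, Algebra.smul_def, map_mul,
        ← IsScalarTower.algebraMap_apply F K B, mul_comm (algebraMap K B y)]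
    rw [h1, h, mul_sub, ← mul_pow, ← mul_assoc, hu, one_mul]
    conv_lhs => rw [show q = q - 1 + 1 by omega]
    rw [pow_succ (algebraMap K B y), mul_assoc, ← mul_assoc (algebraMap K B y), hu, one_mul,
      Nat.sub_add_cancel hq.le]

variable {K : Type*} [Field K] [Algebra F K]

variable (F) in
/-- A polynomial over `K` all of whose exponents are powers of the order of `F`. -/
def Linearized (f : K[X]) : Prop := ∀ m, f.coeff m ≠ 0 → ∃ i, m = q ^ i

/-- Each monomial X^{q^i} is additive and commutes with scalars from `F`. -/
theorem Linearized.comp_sub {f : K[X]} (hf : Linearized F f) (c : F) (v : K) :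
    f.comp (X - C (c • v)) = f - C (c • f.eval v) := by
  have h : f - C (c • f.eval v) = ∑ m ∈ f.support, C (f.coeff m) * X ^ m -
      ∑ m ∈ f.support, C (c • (f.coeff m * v ^ m)) := by
    rw [← f.as_sum_support_C_mul_X_pow, eval_eq_sum, Polynomial.sum, Finset.smul_sum, map_sum]
  rw [h, comp, eval₂_eq_sum, Polynomial.sum, ← Finset.sum_sub_distrib]
  refine Finset.sum_congr rfl fun m hm => ?_
  obtain ⟨i, rfl⟩ := hf m (mem_support_iff.mp hm)
  rw [← smul_C, sub_smul_pow_card_pow, mul_sub, ← C_pow, ← smul_C, mul_smul_comm, ← C_mul]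

theorem Linearized.step {f : K[X]} (hf : Linearized F f) (m : K) :
    Linearized F (f ^ q - C m * f) := by
  intro j hj
  rw [coeff_sub, coeff_C_mul] at hj
  by_cases h : f.coeff j = 0
  · rw [h, mul_zero, sub_zero] at hj
    by_cases hd : q ∣ j
    · obtain ⟨k, rfl⟩ := hd
      rw [coeff_pow_card_mul] at hj
      obtain ⟨i, rfl⟩ := hf k fun h0 => hj (by rw [h0, zero_pow Fintype.card_ne_zero])
      exact ⟨i + 1, by rw [pow_succ']⟩
    · exact absurd (coeff_pow_card_of_not_dvd f hd) hj
  · exact hf j h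

theorem coeff_step_one (f : K[X]) (m : K) :
    (f ^ q - C m * f).coeff 1 = - (m * f.coeff 1) := by
  have hq : 1 < q := Fintype.one_lt_card
  rw [coeff_sub, coeff_C_mul, coeff_pow_card_of_not_dvd, zero_sub]
  rw [Nat.dvd_one]; omega

theorem coeff_step_mul (f : K[X]) (m : K) (j : ℕ) :
    (f ^ q - C m * f).coeff (q * j) = f.coeff j ^ q - m * f.coeff (q * j) := by
  rw [coeff_sub, coeff_C_mul, coeff_pow_card_mul]

variable (F) in
/-- The monic polynomial whose roots are the `F`-linear combinations of `w`, each combination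
being counted separately. -/
def spanPoly {n : ℕ} (w : Fin n → K) : K[X] :=
  ∏ c : Fin n → F, (X - C (∑ i, c i • w i))

/-- For fixed c, the product over the translate by c v of the span is f(X - c v) = f - c f(v); the
product over c is then `prod_sub_smul`. -/
theorem prod_comp_spanPoly {n : ℕ} (w : Fin n → K) (v : K) (hw : Linearized F (spanPoly F w)) :
    ∏ x : F × (Fin n → F), (X - C (x.1 • v + ∑ i, x.2 i • w i)) =
      spanPoly F w ^ q - C ((spanPoly F w).eval v ^ (q - 1)) * spanPoly F w := by
  rw [Fintype.prod_prod_type, map_pow]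
  rw [← algebraMap_eq, ← prod_sub_smul (F := F), algebraMap_eq]
  refine Finset.prod_congr rfl fun c _ => ?_
  rw [← hw.comp_sub, spanPoly, prod_comp]
  refine Finset.prod_congr rfl fun b _ => ?_
  rw [sub_comp, X_comp, C_comp, map_add]
  ring

theorem spanPoly_cons_of_linearized {n : ℕ} (w : Fin n → K) (v : K)
    (hw : Linearized F (spanPoly F w)) :
    spanPoly F (Fin.cons v w : Fin (n + 1) → K) =
      spanPoly F w ^ q - C ((spanPoly F w).eval v ^ (q - 1)) * spanPoly F w := by
  rw [← prod_comp_spanPoly w v hw, spanPoly]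
  refine (Fintype.prod_equiv (Fin.consEquiv fun _ => F) _ _ fun x => ?_).symm
  simp [Fin.sum_univ_succ]

theorem linearized_spanPoly : ∀ {n : ℕ} (w : Fin n → K), Linearized F (spanPoly F w)
  | 0, w => by
    intro m hm
    refine ⟨0, ?_⟩
    by_contra h
    rw [pow_zero] at h
    simp [spanPoly, coeff_X, Ne.symm h] at hm
  | n + 1, w => by
    rw [← Fin.cons_self_tail w, spanPoly_cons_of_linearized _ _ (linearized_spanPoly _)]
    exact (linearized_spanPoly _).step _

theorem spanPoly_cons {n : ℕ} (w : Fin n → K) (v : K) :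
    spanPoly F (Fin.cons v w : Fin (n + 1) → K) =
      spanPoly F w ^ q - C ((spanPoly F w).eval v ^ (q - 1)) * spanPoly F w :=
  spanPoly_cons_of_linearized w v (linearized_spanPoly w)

theorem spanPoly_snoc {n : ℕ} (w : Fin n → K) (v : K) :
    spanPoly F (Fin.snoc w v : Fin (n + 1) → K) =
      spanPoly F w ^ q - C ((spanPoly F w).eval v ^ (q - 1)) * spanPoly F w := by
  rw [← prod_comp_spanPoly w v (linearized_spanPoly w), spanPoly]
  refine (Fintype.prod_equiv (Fin.snocEquiv fun _ => F) _ _ fun x => ?_).symm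
  simp [Fin.sum_univ_castSucc, add_comm]

theorem spanPoly_smul {n : ℕ} (w : Fin n → K) (t : K) :
    (spanPoly F (fun i => t * w i)).comp (C t * X) = C (t ^ q ^ n) * spanPoly F w := by
  have : Fintype.card (Fin n → F) = q ^ n := by simp
  rw [spanPoly, prod_comp, spanPoly, map_pow, ← this, ← Finset.card_univ, ← Finset.prod_const,
    ← Finset.prod_mul_distrib]
  refine Finset.prod_congr rfl fun c _ => ?_
  rw [sub_comp, X_comp, C_comp, mul_sub, ← C_mul, Finset.mul_sum]
  simp only [mul_smul_comm]

variable (F) in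
/-- The coefficient of exponent `q ^ i` of `spanPoly F w`, normalized by that of exponent `1`. -/
def normCoeff {n : ℕ} (w : Fin n → K) (i : ℕ) : K :=
  (spanPoly F w).coeff (q ^ i) / (spanPoly F w).coeff 1

/-- Scaling the roots by t multiplies the coefficient at X^m by a power of t that depends on m. -/
theorem normCoeff_smul {n : ℕ} (w : Fin n → K) {t : K} (ht : t ≠ 0) (i : ℕ) :
    normCoeff F (fun j => t * w j) i * t ^ q ^ i = t * normCoeff F w i := by
  have h : ∀ m, (spanPoly F fun j => t * w j).coeff m * t ^ m =
      t ^ q ^ n * (spanPoly F w).coeff m := by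
    intro m
    have := congrArg (fun f => f.coeff m) (spanPoly_smul (F := F) w t)
    rwa [comp_C_mul_X_coeff, coeff_C_mul] at this
  have h1 := h 1
  have hi := h (q ^ i)
  rw [pow_one] at h1
  have e1 : (spanPoly F fun j => t * w j).coeff 1 = t ^ q ^ n * (spanPoly F w).coeff 1 / t := by
    rw [← h1, mul_div_cancel_right₀ _ ht]
  have hT : t ^ q ^ n ≠ 0 := pow_ne_zero _ ht
  rw [normCoeff, normCoeff, div_mul_eq_mul_div, hi, e1]
  by_cases h0 : (spanPoly F w).coeff 1 = 0
  · simp [h0]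
  · field_simp

/-- The effect on the first two normalized coefficients of passing from `f` to
`f ^ q - m f`. -/
theorem normCoeff_step {n : ℕ} (w : Fin n → K) (w' : Fin (n + 1) → K) (v : K)
    (hw : spanPoly F w' = spanPoly F w ^ q - C ((spanPoly F w).eval v ^ (q - 1)) * spanPoly F w)
    (h' : (spanPoly F w').coeff 1 ≠ 0) :
    let δ := ((spanPoly F w).coeff 1 / (spanPoly F w).eval v) ^ (q - 1)
    normCoeff F w' 1 = normCoeff F w 1 - δ ∧
      normCoeff F w' 2 = normCoeff F w 2 - δ * normCoeff F w 1 ^ q := by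
  have hq : 1 < q := Fintype.one_lt_card
  intro δ
  have c0 := coeff_step_one (F := F) (spanPoly F w) ((spanPoly F w).eval v ^ (q - 1))
  have c1 := coeff_step_mul (F := F) (spanPoly F w) ((spanPoly F w).eval v ^ (q - 1)) 1
  have c2 := coeff_step_mul (F := F) (spanPoly F w) ((spanPoly F w).eval v ^ (q - 1)) q
  rw [← hw] at c0 c1 c2
  rw [mul_one] at c1
  rw [← sq] at c2
  rw [c0] at h'
  simp only [δ, normCoeff, c0, c1, c2, pow_one, div_pow]
  set b := (spanPoly F w).coeff 1
  set m := (spanPoly F w).eval v ^ (q - 1)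
  have hm : m ≠ 0 := by rintro h; simp [h] at h'
  have hb : b ≠ 0 := by rintro h; simp [h] at h'
  have hbq : b ^ q = b ^ (q - 1) * b := by rw [← pow_succ, Nat.sub_add_cancel hq.le]
  constructor
  · rw [hbq]; field_simp; ring
  · rw [hbq]
    have hb' : b ^ (q - 1) ≠ 0 := pow_ne_zero _ hb
    field_simp; ring

/-- The relation between the first two normalized coefficients for the powers of `t`, up to the
error term of the last step. -/
theorem normCoeff_two_sub (t : K) (ht : t ≠ 0) (n : ℕ)
    (h : (spanPoly F fun i : Fin (n + 1) => t ^ (i : ℕ)).coeff 1 ≠ 0) :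
    let w := fun i : Fin n => t ^ (i : ℕ)
    let δ := ((spanPoly F w).coeff 1 / (spanPoly F w).eval (t ^ n)) ^ (q - 1)
    normCoeff F w 2 * (t ^ q ^ 2 - t) = (t ^ q - t) * normCoeff F w 1 ^ (q + 1) +
      δ * normCoeff F w 1 ^ q * (t ^ q ^ 2 - t ^ q) := by
  intro w δ
  have hsnoc : (fun i : Fin (n + 1) => t ^ (i : ℕ)) = Fin.snoc w (t ^ n) := by
    ext i
    refine Fin.lastCases ?_ (fun j => ?_) i <;> simp [w]
  have hcons : (fun i : Fin (n + 1) => t ^ (i : ℕ)) = Fin.cons 1 (fun i => t * w i) := by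
    ext i
    refine Fin.cases ?_ (fun j => ?_) i
    · simp
    · simp [w, pow_succ']
  obtain ⟨s1, s2⟩ := normCoeff_step w (fun i : Fin (n + 1) => t ^ (i : ℕ)) (t ^ n)
    (by rw [hsnoc]; exact spanPoly_snoc _ _) h
  obtain ⟨r1, r2⟩ := normCoeff_step (fun i => t * w i) (fun i : Fin (n + 1) => t ^ (i : ℕ)) 1
    (by rw [hcons]; exact spanPoly_cons _ _) h
  change _ = _ - δ at s1
  change _ = _ - δ * _ at s2
  have e1 := normCoeff_smul (F := F) w ht 1
  have e2 := normCoeff_smul (F := F) w ht 2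
  rw [pow_one] at e1
  set α₁ := normCoeff F w 1
  set α₂ := normCoeff F w 2
  set β₁ := normCoeff F (fun i => t * w i) 1
  set β₂ := normCoeff F (fun i => t * w i) 2
  have e3 : β₁ ^ q * t ^ q ^ 2 = t ^ q * α₁ ^ q := by
    rw [sq (Fintype.card F), pow_mul, ← mul_pow, ← mul_pow, e1]
  -- Both recursions describe the same polynomial, so the ratio belonging to the second one is β₁ -
  -- (α₁ - δ). The scaling relations then eliminate β₁ and β₂.
  rw [s1] at r1
  rw [s2, show ((spanPoly F fun i => t * w i).coeff 1 / (spanPoly F fun i => t * w i).eval 1) ^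
    (q - 1) = β₁ - (α₁ - δ) by rw [r1]; ring] at r2
  have e4 : t ^ q * β₁ = t * α₁ := by rw [← e1]; ring
  linear_combination t ^ q ^ 2 * r2 + e2 - (β₁ - (α₁ - δ)) * e3 - α₁ ^ q * e4

end Linearized

/-! ### Symmetric functions of the powers a^{-(q-1)}, a monic -/

section Monics

variable {F : Type*} [Field F] [Fintype F]

local notation "q" => Fintype.card F

/-- A product over all coefficient vectors, rearranged according to leading coefficients. -/
theorem prod_vec_eq {M : Type*} [CommMonoid M] (d : ℕ) (g : F[X] → M) [DecidableEq F] :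
    ∏ c : Fin (d + 1) → F, g (∑ i, c i • X ^ (i : ℕ)) =
      g 0 * ∏ a ∈ monicsLE F d, ∏ u ∈ Finset.univ.erase (0 : F), g (u • a) := by
  classical
  let vec : (Fin (d + 1) → F) → F[X] := fun c => ∑ i, c i • X ^ (i : ℕ)
  have hcoeff : ∀ (c : Fin (d + 1) → F) (i : Fin (d + 1)), (vec c).coeff i = c i := by
    intro c i
    simp [vec, coeff_smul, coeff_X_pow, Fin.val_inj]
  have hinj : Function.Injective vec := fun b c h => by
    ext i
    rw [← hcoeff b, ← hcoeff c, h]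
  have hmem : ∀ a : F[X], a ∈ Finset.univ.image vec ↔ a.natDegree ≤ d := by
    intro a
    simp only [Finset.mem_image, Finset.mem_univ, true_and]
    constructor
    · rintro ⟨c, rfl⟩
      refine natDegree_sum_le_of_forall_le _ _ fun i _ => ?_
      exact (natDegree_smul_le _ _).trans ((natDegree_X_pow_le _).trans (by omega))
    · intro h
      refine ⟨fun i => a.coeff i, ?_⟩
      conv_rhs => rw [a.as_sum_range' (d + 1) (by omega), Finset.sum_range]
      refine Finset.sum_congr rfl fun i _ => ?_
      rw [smul_X_eq_monomial]
  have h1 : Finset.univ.image vec =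
      insert 0 ((monicsLE F d ×ˢ Finset.univ.erase (0 : F)).image fun x => x.2 • x.1) := by
    ext a
    rw [hmem, Finset.mem_insert, Finset.mem_image]
    constructor
    · intro h
      by_cases ha : a = 0
      · exact Or.inl ha
      · have hl : a.leadingCoeff ≠ 0 := leadingCoeff_ne_zero.mpr ha
        refine Or.inr ⟨(a.leadingCoeff⁻¹ • a, a.leadingCoeff), ?_, smul_inv_smul₀ hl a⟩
        simp only [Finset.mem_product, mem_monicsLE, Finset.mem_erase, Finset.mem_univ, and_true]
        refine ⟨⟨?_, (natDegree_smul_le _ _).trans h⟩, hl⟩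
        rw [smul_eq_C_mul, mul_comm]
        exact monic_mul_leadingCoeff_inv ha
    · rintro (rfl | ⟨x, hx, rfl⟩)
      · simp
      · simp only [Finset.mem_product, mem_monicsLE] at hx
        exact (natDegree_smul_le _ _).trans hx.1.2
  change ∏ c, g (vec c) = _
  rw [← Finset.prod_image (s := Finset.univ) (g := vec) (f := g) fun b _ c _ h => hinj h, h1,
    Finset.prod_insert, Finset.prod_image, Finset.prod_product]
  · rintro ⟨a, u⟩ hx ⟨b, v⟩ hy h
    simp only [Finset.coe_product, Set.mem_prod, Finset.mem_coe, mem_monicsLE, Finset.mem_erase,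
      Finset.mem_univ, and_true] at hx hy h
    have h2 := congrArg leadingCoeff h
    rw [smul_eq_C_mul, smul_eq_C_mul, leadingCoeff_mul, leadingCoeff_mul, hx.1.1.leadingCoeff,
      hy.1.1.leadingCoeff, leadingCoeff_C, leadingCoeff_C, mul_one, mul_one] at h2
    subst h2
    rw [smul_right_injective F[X] hx.2 h]
  · simp only [Finset.mem_image, Finset.mem_product, mem_monicsLE, Finset.mem_erase,
      Finset.mem_univ, and_true, not_exists, not_and, and_imp, Prod.forall]
    intro a u ha _ hu h
    exact (smul_ne_zero hu ha.ne_zero) h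

variable {K : Type*} [Field K] [Algebra F K]

theorem prod_erase_X_sub_C (y : K) [DecidableEq F] :
    ∏ u ∈ Finset.univ.erase (0 : F), (X - C (u • y)) = X ^ (q - 1) - C (y ^ (q - 1)) := by
  have h := prod_sub_smul (F := F) (X : K[X]) y
  have h2 := Finset.mul_prod_erase Finset.univ
    (fun u : F => (X - algebraMap K K[X] (u • y))) (Finset.mem_univ 0)
  rw [h, zero_smul, map_zero, sub_zero] at h2
  refine mul_left_cancel₀ (X_ne_zero (R := K)) ?_
  rw [algebraMap_eq] at h2
  rw [h2, mul_sub, ← pow_succ', Nat.sub_add_cancel Fintype.card_pos, C_pow, mul_comm X]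

/-- The roots are the images of all polynomials of degree at most `d`; grouping the nonzero
multiples of each monic one gives the factors. -/
theorem spanPoly_pow_eq (f : F[X] →ₐ[F] K) (d : ℕ) :
    spanPoly F (fun i : Fin (d + 1) => f X ^ (i : ℕ)) =
      X * ∏ a ∈ monicsLE F d, (X ^ (q - 1) - C (f a ^ (q - 1))) := by
  classical
  have := prod_vec_eq d fun a : F[X] => (X - C (f a))
  rw [map_zero, map_zero, sub_zero] at this
  simp only [map_smul, prod_erase_X_sub_C] at this
  rw [← this, spanPoly]
  simp only [map_sum, map_smul, map_pow]

/-- The function `a ↦ a ^ (-(q - 1))`, with values in an extension of `F[X]`. -/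
def invPow (f : F[X] →ₐ[F] K) : F[X] →* K where
  toFun a := ((f a)⁻¹) ^ (q - 1)
  map_one' := by simp
  map_mul' a b := by rw [map_mul, mul_inv, mul_pow]

theorem invPow_apply (f : F[X] →ₐ[F] K) (a : F[X]) : invPow f a = ((f a)⁻¹) ^ (q - 1) := rfl

theorem prod_one_sub_eq_sum_esymm {ι : Type*} [Fintype ι] (y : ι → K) (z : K[X]) :
    ∏ i, (1 - C (y i) * z) = ∑ j ∈ Finset.range (Fintype.card ι + 1),
      C ((-1) ^ j * MvPolynomial.aeval y (MvPolynomial.esymm ι ℤ j)) * z ^ j := by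
  classical
  simp only [sub_eq_add_neg]
  rw [Finset.prod_one_add, Finset.sum_powerset, Finset.card_univ]
  refine Finset.sum_congr rfl fun j _ => ?_
  rw [MvPolynomial.esymm, map_sum, Finset.mul_sum, map_sum, Finset.sum_mul]
  refine Finset.sum_congr rfl fun t ht => ?_
  rw [map_prod]
  simp only [MvPolynomial.aeval_X]
  have : ∀ i, -(C (y i) * z) = C (y i) * (-z) := fun i => by ring
  simp only [this]
  rw [Finset.prod_mul_distrib, Finset.prod_const, (Finset.mem_powersetCard.mp ht).2, neg_pow,
    map_mul, map_pow, map_neg, map_one, map_prod]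
  ring

/-- The elementary symmetric functions of the `a ^ (-(q - 1))`, for `a` monic of degree at most
`d`. -/
def monicEsymm (f : F[X] →ₐ[F] K) (d j : ℕ) : K :=
  MvPolynomial.aeval (fun a : monicsLE F d => invPow f a)
    (MvPolynomial.esymm (monicsLE F d) ℤ j)

variable {f : F[X] →ₐ[F] K}

/-- The constant by which `spanPoly` differs from its normalization with linear term `X`. -/
theorem exists_spanPoly_pow_eq_C_mul (hf : Function.Injective f) (d : ℕ) :
    ∃ κ : K, κ ≠ 0 ∧ spanPoly F (fun i : Fin (d + 1) => f X ^ (i : ℕ)) =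
      C κ * (X * ∏ a ∈ monicsLE F d, (1 - C (invPow f a) * X ^ (q - 1))) := by
  have hne : ∀ a ∈ monicsLE F d, f a ≠ 0 := fun a ha =>
    (map_ne_zero_iff f hf).mpr (mem_monicsLE.mp ha).1.ne_zero
  refine ⟨∏ a ∈ monicsLE F d, -(f a ^ (q - 1)), ?_, ?_⟩
  · exact Finset.prod_ne_zero_iff.mpr fun a ha => neg_ne_zero.mpr (pow_ne_zero _ (hne a ha))
  · rw [spanPoly_pow_eq, mul_left_comm, map_prod, ← Finset.prod_mul_distrib]
    congr 1
    refine Finset.prod_congr rfl fun a ha => ?_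
    rw [mul_sub, ← mul_assoc, ← C_mul, neg_mul, invPow_apply, ← mul_pow,
      mul_inv_cancel₀ (hne a ha), one_pow]
    simp
    ring

theorem coeff_X_mul_prod_monicsLE (d j : ℕ) :
    (X * ∏ a ∈ monicsLE F d, (1 - C (invPow f a) * X ^ (q - 1))).coeff ((q - 1) * j + 1) =
      (-1) ^ j * monicEsymm f d j := by
  classical
  have hq : 1 < q := Fintype.one_lt_card
  rw [coeff_X_mul, ← Finset.prod_coe_sort,
    prod_one_sub_eq_sum_esymm (fun a : monicsLE F d => invPow f a), finsetSum_coeff]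
  simp only [coeff_C_mul, ← pow_mul, coeff_X_pow, mul_right_inj' (show q - 1 ≠ 0 by omega)]
  simp only [mul_ite, mul_one, mul_zero, Finset.sum_ite_eq]
  split_ifs with h
  · rfl
  · rw [monicEsymm, MvPolynomial.esymm, Finset.powersetCard_eq_empty.mpr, Finset.sum_empty]
    · simp
    · rw [Finset.card_univ]
      simp only [Finset.mem_range] at h
      omega

theorem monicEsymm_zero (d : ℕ) : monicEsymm f d 0 = 1 := by
  simp [monicEsymm]

theorem coeff_one_X_mul_prod_monicsLE (d : ℕ) :
    (X * ∏ a ∈ monicsLE F d, (1 - C (invPow f a) * X ^ (q - 1))).coeff 1 = 1 := by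
  have h := coeff_X_mul_prod_monicsLE (f := f) d 0
  rwa [monicEsymm_zero, mul_zero, zero_add, pow_zero, mul_one] at h

theorem coeff_one_spanPoly_pow_ne_zero (hf : Function.Injective f) (d : ℕ) :
    (spanPoly F (fun i : Fin (d + 1) => f X ^ (i : ℕ))).coeff 1 ≠ 0 := by
  obtain ⟨κ, hκ, h⟩ := exists_spanPoly_pow_eq_C_mul hf d
  rwa [h, coeff_C_mul, coeff_one_X_mul_prod_monicsLE, mul_one]

theorem coeff_spanPoly_div (hf : Function.Injective f) (d j : ℕ) :
    (spanPoly F (fun i : Fin (d + 1) => f X ^ (i : ℕ))).coeff ((q - 1) * j + 1) /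
      (spanPoly F (fun i : Fin (d + 1) => f X ^ (i : ℕ))).coeff 1 =
      (-1) ^ j * monicEsymm f d j := by
  obtain ⟨κ, hκ, h⟩ := exists_spanPoly_pow_eq_C_mul hf d
  rw [h, coeff_C_mul, coeff_C_mul, coeff_one_X_mul_prod_monicsLE, coeff_X_mul_prod_monicsLE]
  field_simp

/-- By linearity a nonzero value forces (q-1)j + 1 to be a power q^i, that is, j = 0, 1, q + 1 or,
for i ≥ 3, j ≥ q² + q + 1 > 2q. -/
theorem monicEsymm_eq_zero (hf : Function.Injective f) (d : ℕ) {j : ℕ} (h2 : 2 ≤ j)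
    (hj : j ≤ 2 * q) (hj' : j ≠ q + 1) : monicEsymm f d j = 0 := by
  have hq : 1 < q := Fintype.one_lt_card
  by_contra hne
  have h := coeff_spanPoly_div hf d j
  obtain ⟨i, hi⟩ := linearized_spanPoly (F := F) (fun i : Fin (d + 1) => f X ^ (i : ℕ))
    ((q - 1) * j + 1) fun h0 => by
      rw [h0, zero_div, eq_comm, mul_eq_zero] at h
      exact h.elim (pow_ne_zero _ (by simp)) hne
  obtain ⟨r, hr⟩ : ∃ r, q = r + 1 := ⟨q - 1, by omega⟩
  rw [hr] at hi hq hj hj'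
  simp only [Nat.add_sub_cancel] at hi
  match i with
  | 0 => nlinarith
  | 1 =>
    have : j = 1 := Nat.eq_of_mul_eq_mul_left (by omega : 0 < r) (by rw [pow_one] at hi; omega)
    omega
  | 2 =>
    exact hj' (Nat.eq_of_mul_eq_mul_left (by omega : 0 < r) (by nlinarith))
  | i + 3 =>
    have h3 : (r + 1) ^ 3 ≤ (r + 1) ^ (i + 3) := Nat.pow_le_pow_right (by omega) (by omega)
    have h4 : r * j ≤ r * (2 * (r + 1)) := Nat.mul_le_mul_left _ hj
    nlinarith [sq_nonneg r]

theorem normCoeff_pow_one (hf : Function.Injective f) (d : ℕ) :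
    normCoeff F (fun i : Fin (d + 1) => f X ^ (i : ℕ)) 1 = -monicEsymm f d 1 := by
  have h := coeff_spanPoly_div hf d 1
  rw [mul_one, Nat.sub_add_cancel Fintype.card_pos] at h
  rw [normCoeff, pow_one, h]
  ring

theorem normCoeff_pow_two (hf : Function.Injective f) (d : ℕ) :
    normCoeff F (fun i : Fin (d + 1) => f X ^ (i : ℕ)) 2 =
      (-1) ^ (q + 1) * monicEsymm f d (q + 1) := by
  have h := coeff_spanPoly_div hf d (q + 1)
  have hq : (q - 1) * (q + 1) + 1 = q ^ 2 := by
    obtain ⟨r, hr⟩ : ∃ r, q = r + 1 := ⟨q - 1, by have := Fintype.card_pos (α := F); omega⟩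
    rw [hr, Nat.add_sub_cancel]; ring
  rw [hq] at h
  rw [normCoeff, h]

/-- At t = `f X ^ (d + 1)` this is the inverse of the ratio whose power is the error term in
`normCoeff_two_sub`. -/
theorem eval_spanPoly_pow_div (hf : Function.Injective f) (d : ℕ) (t : K) :
    (spanPoly F (fun i : Fin (d + 1) => f X ^ (i : ℕ))).eval t /
      (spanPoly F (fun i : Fin (d + 1) => f X ^ (i : ℕ))).coeff 1 =
      t * ∏ a ∈ monicsLE F d, (1 - invPow f a * t ^ (q - 1)) := by
  obtain ⟨κ, hκ, h⟩ := exists_spanPoly_pow_eq_C_mul hf d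
  rw [h, coeff_C_mul, coeff_one_X_mul_prod_monicsLE, mul_one, eval_mul, eval_C, mul_div_cancel_left₀ _ hκ,
    eval_mul, eval_X,
    eval_prod]
  simp

/-- The elementary symmetric functions of index `1` and `q + 1` are related by an exact formula
whose last term tends to zero with growing `d`. -/
theorem monicEsymm_relation (hf : Function.Injective f) (d : ℕ) :
    (-1) ^ (q + 1) * monicEsymm f d (q + 1) * (f X ^ q ^ 2 - f X) =
      (f X ^ q - f X) * monicEsymm f d 1 ^ (q + 1) * (-1) ^ (q + 1) +
      ((f X ^ (d + 1) * ∏ a ∈ monicsLE F d,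
          (1 - invPow f a * (f X ^ (d + 1)) ^ (q - 1)))⁻¹) ^ (q - 1) *
        (-monicEsymm f d 1) ^ q * (f X ^ q ^ 2 - f X ^ q) := by
  have hX : f X ≠ 0 := (map_ne_zero_iff f hf).mpr X_ne_zero
  have h := normCoeff_two_sub (F := F) (f X) hX (d + 1)
    (coeff_one_spanPoly_pow_ne_zero hf (d + 1))
  simp only [normCoeff_pow_one hf, normCoeff_pow_two hf] at h
  rw [← eval_spanPoly_pow_div hf, inv_div, h, neg_pow (monicEsymm f d 1) (q + 1)]
  ring

theorem monicEsymm_one (d : ℕ) :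
    monicEsymm f d 1 = ∑ a ∈ monicsLE F d, invPow f a := by
  rw [monicEsymm, MvPolynomial.esymm_one, map_sum]
  simp only [MvPolynomial.aeval_X]
  exact Finset.sum_coe_sort (monicsLE F d) fun a => invPow f a

theorem sum_monicsLE_pow (hf : Function.Injective f) (d : ℕ) {l : ℕ} (hl : 1 ≤ l) (hlq : l ≤ q) :
    ∑ a ∈ monicsLE F d, invPow f a ^ l = monicEsymm f d 1 ^ l := by
  have h := (newtonRel_aeval (fun a : monicsLE F d => invPow f a)).eq_pow
    (fun j h2 hj hj' => monicEsymm_eq_zero hf d h2 hj hj') hl hlq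
  simp only [MvPolynomial.psum, map_sum, map_pow, MvPolynomial.aeval_X] at h
  rw [Finset.sum_coe_sort (monicsLE F d) fun a => invPow f a ^ l] at h
  exact h

/-- The sum of the values `G p (P ^ (-(q - 1) * l))` over the monic irreducible polynomials of
degree at most `d`, up to an element of the image of `degIdeal F d`. -/
theorem exists_mem_degIdeal_of_sum_G_invPow (hf : Function.Injective f) (p : ℕ)
    [hp : Fact p.Prime] [CharP K p] (d l : ℕ) (hl : 1 ≤ l) (hlq : l ≤ q)
    (hx : ∀ P ∈ primesLE F d, invPow f P ^ l ≠ 1) :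
    ∃ g ∈ degIdeal F d, ∃ w : K, (evalHom (invPow f) : MonoidAlgebra ℤ F[X] →+* K) g =
        (∏ P ∈ primesLE F d, (1 - invPow f P ^ l)) ^ p *
          (monicEsymm f d 1 ^ (l * p) * ∑ P ∈ primesLE F d, G p (invPow f P ^ l) - w) ∧
      (l * p ≤ q → w = 0) ∧
      (q + 1 ≤ l * p → l * p ≤ 2 * q → w = (-1) ^ (q + 1) * l * monicEsymm f d (q + 1) *
        monicEsymm f d 1 ^ (l * p - (q + 1))) := by
  obtain ⟨W, hW⟩ := exists_psum_pow_sub_psum (σ := monicsLE F d) p l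
  obtain ⟨g, hg, hgeq⟩ := exists_mem_degIdeal_of_sum_G p (invPow f) d l hl hx hW
  rw [sum_monicsLE_pow hf d hl hlq, ← pow_mul] at hgeq
  exact ⟨g, hg, _, hgeq, aeval_of_esymm_sparse (fun a : monicsLE F d => invPow f a)
    (fun j h2 hj hj' => monicEsymm_eq_zero hf d h2 hj hj') hW hl hlq⟩

end Monics

/-! ### Ultrametric summation and integrality estimates -/

section Convergence

-- By the ultrametric inequality, enlarging `s` by small terms keeps the partial sum within the same
-- distance of `a`.
open WithZero Filter Topology in
theorem hasSum_of_forall_le_exp {K ι : Type*} [Field K] [Valued K ℤᵐ⁰] (g : ι → K) (a : K)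
    (h : ∀ n : ℕ, ∃ s : Finset ι, Valued.v (∑ i ∈ s, g i - a) ≤ exp (-(n : ℤ)) ∧
      ∀ i ∉ s, Valued.v (g i) ≤ exp (-(n : ℤ))) : HasSum g a := by
  classical
  rw [HasSum, tendsto_def]
  intro U hU
  obtain ⟨γ, hγ⟩ := Valued.mem_nhds.mp hU
  have hmono := MonoidWithZeroHom.ValueGroup₀.embedding_strictMono
    (f := (.ofClass (Valued.v : Valuation K ℤᵐ⁰)))
  set e := MonoidWithZeroHom.ValueGroup₀.embedding γ.1 with he
  have he0 : 0 < e := by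
    simpa using hmono (zero_lt_iff.mpr γ.ne_zero)
  obtain ⟨n, hn⟩ : ∃ n : ℕ, exp (-(n : ℤ)) < e := by
    refine ⟨(1 - log e).toNat, ?_⟩
    rw [← exp_log he0.ne', exp_lt_exp, log_exp]
    have := Int.self_le_toNat (1 - log e)
    omega
  obtain ⟨s, hs, hs'⟩ := h n
  simp only [SummationFilter.unconditional_filter, mem_atTop_sets, Set.mem_preimage]
  refine ⟨s, fun t ht => hγ ?_⟩
  change (Valued.v : Valuation K ℤᵐ⁰).restrict _ < _
  rw [← hmono.lt_iff_lt, Valuation.embedding_restrict]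
  refine lt_of_le_of_lt ?_ hn
  rw [← Finset.sum_sdiff ht, add_sub_assoc]
  exact Valued.v.map_add_le
    (Valued.v.map_sum_le fun i hi => hs' i (Finset.mem_sdiff.mp hi).2) hs

theorem coeff_zero_numer (p : ℕ) (hp : p.Prime) : (numer p).coeff 0 = 0 := by
  have h := congrArg (fun g : ℤ[X] => g.coeff 0) (C_mul_numer p hp)
  simp only [coeff_C_mul] at h
  have h2 : ((1 - X ^ p : ℤ[X]) - (1 - X) ^ p).coeff 0 = 0 := by
    rw [coeff_zero_eq_eval_zero]
    simp [hp.ne_zero]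
  rw [h2] at h
  exact (mul_eq_zero.mp h).resolve_left (by exact_mod_cast hp.ne_zero)

variable {K Γ : Type*} [Field K] [LinearOrderedCommGroupWithZero Γ] (v : Valuation K Γ)

theorem valuation_intCast_le_one (n : ℤ) : v (n : K) ≤ 1 := intCast_mem v.integer n

theorem valuation_natCast_le_one (n : ℕ) : v (n : K) ≤ 1 := natCast_mem v.integer n

theorem valuation_aeval_int_le_one (g : ℤ[X]) {u : K} (hu : v u ≤ 1) : v (aeval u g) ≤ 1 := by
  rw [aeval_eq_sum_range]
  refine v.map_sum_le fun i _ => ?_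
  rw [zsmul_eq_mul, map_mul, map_pow]
  exact mul_le_one' (valuation_intCast_le_one v _) (pow_le_one' hu _)

/-- The numerator has integer coefficients and no constant term, and the denominator is a unit. -/
theorem valuation_G_le (p : ℕ) (hp : p.Prime) {u : K} (hu : v u < 1) : v (G p u) ≤ v u := by
  rw [G, map_div₀, map_pow, v.map_one_sub_of_lt hu, one_pow, div_one,
    ← divX_mul_X_add (numer p), coeff_zero_numer p hp]
  simp only [map_zero, add_zero, map_mul, aeval_X]
  exact mul_le_of_le_one_left' (valuation_aeval_int_le_one v _ hu.le)

theorem valuation_evalHom_le {F : Type*} [Field F] (x : F[X] →* K) {d : ℕ} {γ : Γ}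
    (hx1 : ∀ a, v (x a) ≤ 1) (hx : ∀ a, a = 0 ∨ d < a.natDegree → v (x a) ≤ γ)
    {g : MonoidAlgebra ℤ F[X]} (hg : g ∈ degIdeal F d) :
    v ((evalHom x : MonoidAlgebra ℤ F[X] →+* K) g) ≤ γ := by
  induction hg using Submodule.span_induction with
  | mem g h =>
    obtain ⟨a, ha, rfl⟩ := h
    rw [RingHom.coe_coe, evalHom, MonoidAlgebra.lift_of]
    exact hx a ha
  | zero => rw [map_zero, map_zero]; exact zero_le
  | add g h _ _ h1 h2 => rw [map_add]; exact v.map_add_le h1 h2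
  | smul c g _ h =>
    rw [smul_eq_mul, map_mul, map_mul]
    refine (mul_le_of_le_one_left' ?_).trans h
    rw [RingHom.coe_coe, evalHom, MonoidAlgebra.lift_apply]
    refine v.map_sum_le fun a _ => ?_
    beta_reduce
    rw [zsmul_eq_mul, map_mul]
    exact mul_le_one' (valuation_intCast_le_one _ _) (hx1 a)

end Convergence

/-! ### Estimates for the valuation at infinity -/

section Infinity

open WithZero

variable {F : Type*} [Field F]

variable (F) in
/-- The inclusion of `F[X]` in `RatFunc F`. -/
def polyHom : F[X] →ₐ[F] RatFunc F := IsScalarTower.toAlgHom F F[X] (RatFunc F)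

theorem polyHom_injective : Function.Injective (polyHom F) := RatFunc.algebraMap_injective F

theorem polyHom_X : polyHom F X = RatFunc.X := RatFunc.algebraMap_X

theorem valuation_polyHom [DecidableEq (RatFunc F)] {a : F[X]} (ha : a ≠ 0) :
    RatFunc.inftyValuation F (polyHom F a) = exp (a.natDegree : ℤ) :=
  RatFunc.inftyValuation.polynomial F ha

variable [Fintype F]

variable [DecidableEq (RatFunc F)]

local notation "q" => Fintype.card F

theorem valuation_invPow {a : F[X]} (ha : a ≠ 0) :
    RatFunc.inftyValuation F (invPow (polyHom F) a) = exp (-(a.natDegree : ℤ)) ^ (q - 1) := by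
  rw [invPow_apply, map_pow, map_inv₀, valuation_polyHom ha, exp_neg]

theorem valuation_invPow_le (a : F[X]) :
    RatFunc.inftyValuation F (invPow (polyHom F) a) ≤ exp (-(a.natDegree : ℤ)) := by
  have hq : 1 < q := Fintype.one_lt_card
  by_cases ha : a = 0
  · rw [ha, invPow_apply, map_zero, inv_zero, zero_pow (by omega), map_zero]
    exact zero_le
  · rw [valuation_invPow ha]
    refine pow_le_of_le_one zero_le ?_ (by omega)
    rw [← exp_zero, exp_le_exp]
    omega

theorem valuation_invPow_lt_one {a : F[X]} (ha : 0 < a.natDegree) :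
    RatFunc.inftyValuation F (invPow (polyHom F) a) < 1 := by
  refine (valuation_invPow_le a).trans_lt ?_
  rw [← exp_zero, exp_lt_exp]
  omega

theorem valuation_invPow_le_one (a : F[X]) :
    RatFunc.inftyValuation F (invPow (polyHom F) a) ≤ 1 := by
  refine (valuation_invPow_le a).trans ?_
  rw [← exp_zero, exp_le_exp]
  omega

theorem valuation_evalHom_le_of_mem_degIdeal {d : ℕ} {g : MonoidAlgebra ℤ F[X]}
    (hg : g ∈ degIdeal F d) :
    RatFunc.inftyValuation F
      ((evalHom (invPow (polyHom F)) : MonoidAlgebra ℤ F[X] →+* RatFunc F) g) ≤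
      exp (-(d : ℤ)) := by
  refine valuation_evalHom_le _ _ valuation_invPow_le_one (fun a ha => ?_) hg
  rcases ha with rfl | ha
  · have hq : 1 < q := Fintype.one_lt_card
    rw [invPow_apply, map_zero, inv_zero, zero_pow (by omega), map_zero]
    exact zero_le
  · refine (valuation_invPow_le a).trans ?_
    rw [exp_le_exp]
    omega

/-- The term of a = 1 dominates: every other monic polynomial has positive degree. -/
theorem valuation_sum_monicsLE_pow (d : ℕ) {m : ℕ} (hm : 1 ≤ m) :
    RatFunc.inftyValuation F (∑ a ∈ monicsLE F d, invPow (polyHom F) a ^ m) = 1 := by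
  classical
  have h1 : (1 : F[X]) ∈ monicsLE F d := by simp [monic_one]
  rw [← Finset.add_sum_erase _ _ h1, map_one, one_pow]
  refine Valuation.map_one_add_of_lt _ (Valuation.map_sum_lt _ one_ne_zero fun a ha => ?_)
  rw [Finset.mem_erase, mem_monicsLE] at ha
  rw [map_pow]
  refine pow_lt_one₀ zero_le (valuation_invPow_lt_one ?_) (by omega)
  rw [Nat.pos_iff_ne_zero]
  exact fun h => ha.1 (ha.2.1.natDegree_eq_zero.mp h)

theorem valuation_invPow_pow_lt_one {P : F[X]} (hP : Irreducible P) {l : ℕ} (hl : 1 ≤ l) :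
    RatFunc.inftyValuation F (invPow (polyHom F) P ^ l) < 1 := by
  rw [map_pow]
  exact pow_lt_one₀ zero_le (valuation_invPow_lt_one hP.natDegree_pos) (by omega)

theorem valuation_prod_primesLE (d : ℕ) {l : ℕ} (hl : 1 ≤ l) :
    RatFunc.inftyValuation F (∏ P ∈ primesLE F d, (1 - invPow (polyHom F) P ^ l)) = 1 := by
  rw [map_prod]
  refine Finset.prod_eq_one fun P hP => ?_
  exact Valuation.map_one_sub_of_lt _
    (valuation_invPow_pow_lt_one (mem_primesLE.mp hP).2 hl)

theorem valuation_monicEsymm_one (d : ℕ) :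
    RatFunc.inftyValuation F (monicEsymm (polyHom F) d 1) = 1 := by
  simpa [monicEsymm_one] using valuation_sum_monicsLE_pow (F := F) d le_rfl

/-- For deg a ≤ d the quotient T^{d+1}/a has positive degree, so every factor of the product is
large and the power of T alone gives the bound. -/
theorem valuation_error_le (d : ℕ) :
    RatFunc.inftyValuation F (((RatFunc.X ^ (d + 1) * ∏ a ∈ monicsLE F d,
      (1 - invPow (polyHom F) a * (RatFunc.X ^ (d + 1)) ^ (q - 1)))⁻¹) ^ (q - 1)) ≤
        exp (-(d : ℤ)) := by
  have hq : 1 < q := Fintype.one_lt_card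
  have hX : RatFunc.inftyValuation F (RatFunc.X ^ (d + 1)) = exp ((d + 1 : ℕ) : ℤ) := by
    rw [map_pow, RatFunc.inftyValuation.X, ← exp_nsmul]
    simp
  have hfac : ∀ a ∈ monicsLE F d, 1 ≤ RatFunc.inftyValuation F
      (1 - invPow (polyHom F) a * (RatFunc.X ^ (d + 1)) ^ (q - 1)) := by
    intro a ha
    rw [mem_monicsLE] at ha
    have h1 : 1 < RatFunc.inftyValuation F
        (invPow (polyHom F) a * (RatFunc.X ^ (d + 1)) ^ (q - 1)) := by
      rw [map_mul, valuation_invPow ha.1.ne_zero, map_pow _ (RatFunc.X ^ (d + 1)), hX, ← mul_pow,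
        ← exp_add]
      refine one_lt_pow₀ ?_ (by omega)
      rw [← exp_zero, exp_lt_exp]
      omega
    rw [Valuation.map_sub_eq_of_lt_right _ (by rwa [map_one])]
    exact h1.le
  have h2 : exp (d : ℤ) ≤ RatFunc.inftyValuation F (RatFunc.X ^ (d + 1) * ∏ a ∈ monicsLE F d,
      (1 - invPow (polyHom F) a * (RatFunc.X ^ (d + 1)) ^ (q - 1))) := by
    rw [map_mul, hX, map_prod]
    refine le_trans ?_ (le_mul_of_one_le_right zero_le (Finset.one_le_prod' hfac))
    rw [exp_le_exp]
    omega
  rw [map_pow, map_inv₀]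
  have h3 : (RatFunc.inftyValuation F (RatFunc.X ^ (d + 1) * ∏ a ∈ monicsLE F d,
      (1 - invPow (polyHom F) a * (RatFunc.X ^ (d + 1)) ^ (q - 1))))⁻¹ ≤ exp (-(d : ℤ)) := by
    rw [exp_neg]
    exact inv_anti₀ exp_pos h2
  refine (pow_le_of_le_one zero_le (h3.trans ?_) (by omega)).trans h3
  rw [← exp_zero, exp_le_exp]
  omega

end Infinity

/-! ### The limit and the convergence of the sum -/

section Main

open WithZero

variable {F : Type*} [Field F]

theorem valuation_algebraMap_completion [DecidableEq (RatFunc F)] (x : RatFunc F) :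
    Valued.v (algebraMap (RatFunc F) (RatFunc.CompletionAtInfty F) x) =
      RatFunc.inftyValuation F x :=
  @Valued.valuedCompletion_apply (RatFunc F) _ _ _ (RatFunc.inftyValued F) x

variable (F) in
theorem X_pow_sub_X_ne_zero {n : ℕ} (hn : 1 < n) :
    (RatFunc.X ^ n - RatFunc.X : RatFunc F) ≠ 0 := by
  have h := (map_ne_zero_iff _ (polyHom_injective (F := F))).mpr
    (FiniteField.X_pow_card_sub_X_ne_zero F hn)
  rwa [map_sub, map_pow, polyHom_X] at h

variable [Fintype F]

local notation "q" => Fintype.card F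

variable (F) in
theorem neg_one_pow_card_add_one : ((-1) ^ (q + 1) : RatFunc F) = 1 := by
  have h : ((-1) ^ q : RatFunc F) = -1 := by
    have := map_neg (FiniteField.frobeniusAlgHom F (RatFunc F)) 1
    simpa using this
  rw [pow_succ, h]
  ring

-- By Frobenius T^{q²} - T^q = (T^q - T)^q, which cancels against the numerator.
variable (F) in
theorem limit_eq (l : RatFunc F) :
    l * (RatFunc.X ^ q - RatFunc.X) ^ (q + 1) /
      ((RatFunc.X ^ (q ^ 2) - RatFunc.X ^ q) * (RatFunc.X ^ (q ^ 2) - RatFunc.X)) =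
    l * ((RatFunc.X ^ q - RatFunc.X) / (RatFunc.X ^ (q ^ 2) - RatFunc.X)) := by
  have hq : 1 < q := Fintype.one_lt_card
  have h1 := X_pow_sub_X_ne_zero F hq
  have h2 := X_pow_sub_X_ne_zero F (Nat.one_lt_pow two_ne_zero hq)
  have h3 : (RatFunc.X ^ (q ^ 2) - RatFunc.X ^ q : RatFunc F) =
      (RatFunc.X ^ q - RatFunc.X) ^ q := by
    have := map_sub (FiniteField.frobeniusAlgHom F (RatFunc F)) (RatFunc.X ^ q) RatFunc.X
    simp only [FiniteField.coe_frobeniusAlgHom] at this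
    rw [this, sq, pow_mul]
  rw [h3, pow_succ]
  field_simp

variable (F) in
/-- The monic irreducible polynomials of degree at most `d`, as elements of the subtype. -/
def irreducibleLE (d : ℕ) : Finset (MonicIrreducible F) := by
  classical
  exact (primesLE F d).subtype fun P => P.Monic ∧ Irreducible P

theorem mem_irreducibleLE {d : ℕ} {P : MonicIrreducible F} :
    P ∈ irreducibleLE F d ↔ P.1.natDegree ≤ d := by
  classical
  rw [irreducibleLE, Finset.mem_subtype, mem_primesLE]
  exact ⟨fun h => h.1.2, fun h => ⟨⟨P.2.1, h⟩, P.2.2⟩⟩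

theorem sum_irreducibleLE {M : Type*} [AddCommMonoid M] (d : ℕ) (g : F[X] → M) :
    ∑ P ∈ irreducibleLE F d, g P.1 = ∑ P ∈ primesLE F d, g P := by
  classical
  rw [irreducibleLE]
  exact Finset.sum_subtype_of_mem g fun P hP => by
    rw [mem_primesLE] at hP; exact ⟨hP.1.1, hP.2⟩

variable [DecidableEq (RatFunc F)]

/-- The relation between the elementary symmetric functions of index `1` and `q + 1`. -/
theorem valuation_monicEsymm_sub_le (d : ℕ) :
    RatFunc.inftyValuation F (monicEsymm (polyHom F) d (q + 1) -
      (RatFunc.X ^ q - RatFunc.X) / (RatFunc.X ^ (q ^ 2) - RatFunc.X) *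
        monicEsymm (polyHom F) d 1 ^ (q + 1)) ≤ exp (-(d : ℤ)) := by
  have hq : 1 < q := Fintype.one_lt_card
  have hq2 : 1 < q ^ 2 := Nat.one_lt_pow two_ne_zero hq
  have h2 := X_pow_sub_X_ne_zero F hq2
  have hrel := monicEsymm_relation (polyHom_injective (F := F)) d
  rw [neg_one_pow_card_add_one, one_mul, mul_one, polyHom_X] at hrel
  set δ := ((RatFunc.X ^ (d + 1) * ∏ a ∈ monicsLE F d,
    (1 - invPow (polyHom F) a * (RatFunc.X ^ (d + 1)) ^ (q - 1)))⁻¹) ^ (q - 1)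
  have hδ : RatFunc.inftyValuation F δ ≤ exp (-(d : ℤ)) := valuation_error_le d
  have hX : ∀ n : ℕ, RatFunc.inftyValuation F (RatFunc.X ^ n) = exp (n : ℤ) := by
    intro n
    rw [map_pow, RatFunc.inftyValuation.X, ← exp_nsmul]
    simp
  have hden : RatFunc.inftyValuation F (RatFunc.X ^ (q ^ 2) - RatFunc.X) =
      exp ((q ^ 2 : ℕ) : ℤ) := by
    rw [Valuation.map_sub_eq_of_lt_left, hX]
    rw [hX, RatFunc.inftyValuation.X, exp_lt_exp]
    exact_mod_cast hq2
  have hnum : RatFunc.inftyValuation F (RatFunc.X ^ (q ^ 2) - RatFunc.X ^ q) ≤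
      exp ((q ^ 2 : ℕ) : ℤ) := by
    refine Valuation.map_sub_le _ (hX _).le ?_
    rw [hX, exp_le_exp]
    exact_mod_cast Nat.le_self_pow two_ne_zero q
  have key : monicEsymm (polyHom F) d (q + 1) -
      (RatFunc.X ^ q - RatFunc.X) / (RatFunc.X ^ (q ^ 2) - RatFunc.X) *
        monicEsymm (polyHom F) d 1 ^ (q + 1) =
      δ * (-monicEsymm (polyHom F) d 1) ^ q *
        ((RatFunc.X ^ q ^ 2 - RatFunc.X ^ q) / (RatFunc.X ^ (q ^ 2) - RatFunc.X)) := by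
    field_simp
    linear_combination hrel
  rw [key, map_mul, map_mul, map_pow _ (-_), Valuation.map_neg, valuation_monicEsymm_one, one_pow,
    mul_one, map_div₀, hden]
  refine (mul_le_of_le_one_right' ?_).trans hδ
  exact div_le_one_of_le₀ hnum zero_le

variable {p : ℕ} [hp : Fact p.Prime]

theorem hasSum_completion {l : ℕ} (hl : 1 ≤ l) (b : RatFunc F)
    (hb : ∀ d : ℕ, RatFunc.inftyValuation F
      (∑ P ∈ primesLE F d, G p (invPow (polyHom F) P ^ l) - b) ≤ exp (-(d : ℤ))) :
    HasSum (fun P : MonicIrreducible F =>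
      algebraMap (RatFunc F) (RatFunc.CompletionAtInfty F) (G p (invPow (polyHom F) P.1 ^ l)))
      (algebraMap (RatFunc F) (RatFunc.CompletionAtInfty F) b) := by
  refine hasSum_of_forall_le_exp _ _ fun n => ⟨irreducibleLE F n, ?_, fun P hP => ?_⟩
  · rw [← map_sum, ← map_sub, valuation_algebraMap_completion,
      sum_irreducibleLE n fun P => G p (invPow (polyHom F) P ^ l)]
    exact hb n
  · rw [mem_irreducibleLE, not_le] at hP
    rw [valuation_algebraMap_completion]
    refine (valuation_G_le _ p hp.out (valuation_invPow_pow_lt_one P.2.2 hl)).trans ?_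
    rw [map_pow]
    refine (pow_le_of_le_one zero_le (valuation_invPow_le_one _) (by omega)).trans ?_
    refine (valuation_invPow_le _).trans ?_
    rw [exp_le_exp]
    omega

variable [CharP F p]

/-- The partial sums over the monic irreducible polynomials of degree at most `d`, compared with
the elementary symmetric functions. -/
theorem valuation_sum_G_sub_le (d l : ℕ) (hl : 1 ≤ l) (hlq : l ≤ q) :
    (l * p ≤ q → RatFunc.inftyValuation F
      (∑ P ∈ primesLE F d, G p (invPow (polyHom F) P ^ l)) ≤ exp (-(d : ℤ))) ∧
    (q + 1 ≤ l * p → l * p ≤ 2 * q → RatFunc.inftyValuation F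
      (∑ P ∈ primesLE F d, G p (invPow (polyHom F) P ^ l) -
        (l : RatFunc F) * ((RatFunc.X ^ q - RatFunc.X) / (RatFunc.X ^ (q ^ 2) - RatFunc.X))) ≤
          exp (-(d : ℤ))) := by
  have : CharP (RatFunc F) p := charP_of_injective_algebraMap
    (algebraMap F (RatFunc F)).injective p
  obtain ⟨g, hg, w, hgeq, hW1, hW2⟩ := exists_mem_degIdeal_of_sum_G_invPow
    (polyHom_injective (F := F)) p d l hl hlq (fun P hP h => by
      have := valuation_invPow_pow_lt_one (mem_primesLE.mp hP).2 hl
      rw [h, map_one] at this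
      exact lt_irrefl _ this)
  have hv := valuation_evalHom_le_of_mem_degIdeal hg
  rw [hgeq, map_mul, map_pow, valuation_prod_primesLE d hl, one_pow, one_mul] at hv
  have hE := valuation_monicEsymm_one (F := F) d
  have hEpow : ∀ m : ℕ, ∀ z : RatFunc F, RatFunc.inftyValuation F
      (monicEsymm (polyHom F) d 1 ^ m * z) = RatFunc.inftyValuation F z := by
    intro m z
    rw [map_mul, map_pow, hE, one_pow, one_mul]
  refine ⟨fun h => ?_, fun h h' => ?_⟩
  · rwa [hW1 h, sub_zero, hEpow] at hv
  · have hW3 := hW2 h h'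
    rw [neg_one_pow_card_add_one, one_mul] at hW3
    rw [hW3] at hv
    rw [← hEpow (l * p)]
    have e : monicEsymm (polyHom F) d 1 ^ (l * p) =
        monicEsymm (polyHom F) d 1 ^ (l * p - (q + 1)) * monicEsymm (polyHom F) d 1 ^ (q + 1) := by
      rw [← pow_add, Nat.sub_add_cancel h]
    -- The first summand is the error of the truncated Euler products, the second that of replacing
    -- e_{q+1} by its limiting multiple of e_1^{q+1}.
    have key : monicEsymm (polyHom F) d 1 ^ (l * p) *
        (∑ P ∈ primesLE F d, G p (invPow (polyHom F) P ^ l) -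
          (l : RatFunc F) * ((RatFunc.X ^ q - RatFunc.X) / (RatFunc.X ^ (q ^ 2) - RatFunc.X))) =
        (monicEsymm (polyHom F) d 1 ^ (l * p) *
          ∑ P ∈ primesLE F d, G p (invPow (polyHom F) P ^ l) -
          (l : RatFunc F) * monicEsymm (polyHom F) d (q + 1) *
            monicEsymm (polyHom F) d 1 ^ (l * p - (q + 1))) +
        monicEsymm (polyHom F) d 1 ^ (l * p - (q + 1)) *
          ((l : RatFunc F) * (monicEsymm (polyHom F) d (q + 1) -
            (RatFunc.X ^ q - RatFunc.X) / (RatFunc.X ^ (q ^ 2) - RatFunc.X) *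
              monicEsymm (polyHom F) d 1 ^ (q + 1))) := by
      rw [e]; ring
    rw [key]
    refine Valuation.map_add_le _ hv ?_
    rw [hEpow, map_mul]
    exact (mul_le_of_le_one_left' (valuation_natCast_le_one _ _)).trans
      (valuation_monicEsymm_sub_le d)

end Main

end PrimeSums

end

theorem theorem1p5 (p : ℕ) [Fact p.Prime] (F : Type*) [Field F] [Fintype F] [CharP F p]
    [DecidableEq (RatFunc F)] (q : ℕ) (hq : q = Fintype.card F) (k ℓ : ℕ)
    (hk : k = (q - 1) * ℓ) :
    (1 ≤ ℓ → ℓ ≤ q / p →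
      HasSum
        (fun P : PrimeSums.MonicIrreducible F =>
          algebraMap (RatFunc F) (RatFunc.CompletionAtInfty F)
            (PrimeSums.G p (1 / (algebraMap F[X] (RatFunc F) P.1) ^ k)))
        0) ∧
    (q / p + 1 < ℓ → ℓ ≤ 2 * q / p →
      HasSum
        (fun P : PrimeSums.MonicIrreducible F =>
          algebraMap (RatFunc F) (RatFunc.CompletionAtInfty F)
            (PrimeSums.G p (1 / (algebraMap F[X] (RatFunc F) P.1) ^ k)))
        (algebraMap (RatFunc F) (RatFunc.CompletionAtInfty F)
          ((ℓ : RatFunc F) * (RatFunc.X ^ q - RatFunc.X) ^ (q + 1) /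
            ((RatFunc.X ^ (q ^ 2) - RatFunc.X ^ q) * (RatFunc.X ^ (q ^ 2) - RatFunc.X))))) := by
  have hp : p.Prime := Fact.out
  subst hq hk
  have hterm : ∀ P : F[X], 1 / (algebraMap F[X] (RatFunc F) P) ^ ((Fintype.card F - 1) * ℓ) =
      PrimeSums.invPow (PrimeSums.polyHom F) P ^ ℓ := by
    intro P
    rw [PrimeSums.invPow_apply, ← pow_mul, inv_pow, one_div]
    rfl
  simp only [hterm]
  have hmul : ∀ n, ℓ ≤ n / p → ℓ * p ≤ n := fun n h =>
    (Nat.mul_le_mul_right p h).trans (Nat.div_mul_le_self n p)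
  constructor
  · intro h1 h2
    have h3 := hmul _ h2
    have hle : ℓ ≤ Fintype.card F := h2.trans (Nat.div_le_self _ _)
    rw [← map_zero (algebraMap (RatFunc F) (RatFunc.CompletionAtInfty F))]
    refine PrimeSums.hasSum_completion h1 0 fun d => ?_
    rw [sub_zero]
    exact (PrimeSums.valuation_sum_G_sub_le d ℓ h1 hle).1 h3
  · intro h1 h2
    have h3 := hmul _ h2
    -- From 2ℓ ≤ ℓp ≤ 2q; this bound keeps Z_ℓ in the range where it equals e_1^ℓ.
    have hle : ℓ ≤ Fintype.card F := by nlinarith [hp.two_le]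
    have h4 : Fintype.card F < ℓ * p := (Nat.div_lt_iff_lt_mul hp.pos).mp (by omega)
    have h0 : 1 ≤ ℓ := le_trans (Nat.le_add_left 1 _) h1.le
    rw [PrimeSums.limit_eq]
    exact PrimeSums.hasSum_completion h0 _ fun d =>
      (PrimeSums.valuation_sum_G_sub_le d ℓ h0 hle).2 h4 h3
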